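/- Let $d\ge 1$. A potential is a function $W:\mathbb{R}^d\to\mathbb{R}\cup\{\infty\}$ that is locally integrable, bounded from below on compact sets, lower semicontinuous and even. For a compactly supported finite positive measure $\rho$ put $E[\rho]=\frac12\iint W(x-y)\,d\rho(y)\,d\rho(x)\in\mathbb{R}\cup\{\infty\}$, and use the same formula for $E[\mu]\in\mathbb{R}$ when $\mu$ is a compactly supported finite signed measure with $E[|\mu|]<\infty$, where $|\mu|$ is its total variation. Put $\hat\mu(\xi)=\int e^{-2\pi i x\cdot\xi}\,d\mu(x)$, and let $\hat W$ be the Fourier transform of $W$ as a tempered distribution, with the same normalization. For an integer $k\ge 0$, $W$ is called Fourier representable at level $k$ if it is a potential in the above sense and a tempered distribution, $\hat W$ is a (real-valued) locally integrable function on $\mathbb{R}^d\setminus\{0\}$, and $$E[\mu]=\frac12\int_{\mathbb{R}^d\setminus\{0\}}\hat W(\xi)\,|\hat\mu(\xi)|^2\,d\xi ,$$ with an absolutely convergent integral, for every compactly supported finite signed measure $\mu$ on $\mathbb{R}^d$ with $E[|\mu|]<\infty$ and $\int x^{\otimes j}\,d\mu(x)=0$ for $j=0,1,\dots,k-1$.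 Here $\frac{|x|^0}{0}$ is understood as $\ln|x|$, and the value of each potential below at $x=0$ is its limit as $x\to0$ (possibly $+\infty$). **Theorem.** 1. The repulsive power-law potential $W_b(x)=-\frac{|x|^b}{b}$ is Fourier representable at level $0$ if $-d<b<0$, at level $1$ if $0\le b<2$, and at level $2$ if $2\le b<4$. 2. The attractive-repulsive power-law potential $W_{a,b}(x)=\frac{|x|^a}{a}-\frac{|x|^b}{b}$ is Fourier representable at level $2$ if $-d<b<a<4$. 3. The logarithmic power-law potential $W_{b,\ln}(x)=\frac{|x|^b}{b}\ln|x|$ is Fourier representable at level $0$ if $-d<b<0$, at level $1$ if $0<b<2$, and at level $2$ if $2\le b<4$. -/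

import Mathlib

open MeasureTheory
open scoped FourierTransform SchwartzMap

noncomputable section

namespace InteractionEnergy

/-- Euclidean space `ℝ^d`. -/
abbrev Space (d : ℕ) : Type := EuclideanSpace ℝ (Fin d)

/-! ### Potentials -/

/-- `r ^ c / c`, understood as `log r` when `c = 0`. -/
def powQuot (c r : ℝ) : ℝ := if c = 0 then Real.log r else r ^ c / c

/-- The repulsive power-law potential `-|x|^b / b`. Its value at the origin is its limit there,
which is `+∞` for `b ≤ 0` and `0` for `b > 0`. -/
def powerPotential (d : ℕ) (b : ℝ) (x : Space d) : EReal :=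
  if x = 0 ∧ b ≤ 0 then ⊤ else ((-powQuot b ‖x‖ : ℝ) : EReal)

/-- The attractive-repulsive power-law potential `|x|^a / a - |x|^b / b` (used for `b < a`).
Its value at the origin is its limit there, which is `+∞` for `b ≤ 0` and `0` for `b > 0`. -/
def attrRepPotential (d : ℕ) (a b : ℝ) (x : Space d) : EReal :=
  if x = 0 ∧ b ≤ 0 then ⊤ else ((powQuot a ‖x‖ - powQuot b ‖x‖ : ℝ) : EReal)

/-- The logarithmic power-law potential `(|x|^b / b) log |x|` (used for `b ≠ 0`).
Its value at the origin is its limit there, which is `+∞` for `b < 0` and `0` for `b > 0`. -/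
def logPowerPotential (d : ℕ) (b : ℝ) (x : Space d) : EReal :=
  if x = 0 ∧ b < 0 then ⊤ else ((‖x‖ ^ b / b * Real.log ‖x‖ : ℝ) : EReal)

variable {d : ℕ}

/-- The standing assumption on an interaction potential `W : ℝ^d → ℝ ∪ {∞}`: it is locally
integrable, bounded from below on compact sets, lower semicontinuous and even. -/
structure IsPotential (W : Space d → EReal) : Prop where
  ae_ne_top : ∀ᵐ x, W x ≠ ⊤
  locallyIntegrable : LocallyIntegrable fun x => (W x).toReal
  bddBelow_on_compact : ∀ K : Set (Space d), IsCompact K → ∃ m : ℝ, ∀ x ∈ K, (m : EReal) ≤ W x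
  lowerSemicontinuous : LowerSemicontinuous W
  even : ∀ x, W (-x) = W x

/-! ### Energies -/

/-- The energy `E[ρ] = ½ ∬ W(x - y) dρ(y) dρ(x)` of a positive measure, with values in
`ℝ ∪ {∞}`, as the difference of the integrals of the positive and of the negative part of `W`.
For a compactly supported finite measure `ρ` and a potential that is bounded below on compact
sets, the subtracted term is finite. -/
def energy (W : Space d → EReal) (ρ : Measure (Space d)) : EReal :=
  ((1 / 2 : ℝ) : EReal) *
    (((∫⁻ x, ∫⁻ y, (W (x - y)).toENNReal ∂ρ ∂ρ : ENNReal) : EReal) -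
      ((∫⁻ x, ∫⁻ y, (-W (x - y)).toENNReal ∂ρ ∂ρ : ENNReal) : EReal))

/-- The energy `E[μ] = ½ ∬ W(x - y) dμ(y) dμ(x)` of a signed measure. It is used only when
`E[|μ|] < ∞`; then `W(x - y)` is finite almost everywhere and integrable for `|μ| ⊗ |μ|`. -/
def signedEnergy (W : Space d → EReal) (μ : SignedMeasure (Space d)) : ℝ :=
  (1 / 2) * ∫ᵛ x, (∫ᵛ y, (W (x - y)).toReal ∂<•μ) ∂<•μ

/-- The signed measure `μ` has compact support. -/
def CompactlySupported (μ : SignedMeasure (Space d)) : Prop :=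
  ∃ K : Set (Space d), IsCompact K ∧ μ.totalVariation Kᶜ = 0

/-- All coordinates of the tensor `∫ x^{⊗ j} dμ(x)` vanish. -/
def MomentVanishes (μ : SignedMeasure (Space d)) (j : ℕ) : Prop :=
  ∀ i : Fin j → Fin d, ∫ᵛ x, (∏ l, x (i l)) ∂<•μ = 0

/-- The Fourier transform `∫ exp(-2πi x·ξ) dμ(x)` of a signed measure. -/
def fourierSigned (μ : SignedMeasure (Space d)) (ξ : Space d) : ℂ :=
  ∫ᵛ x, Complex.exp (-2 * Real.pi * Complex.I * (inner ℝ x ξ : ℝ)) ∂<•μ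

/-! ### Fourier representability -/

/-- `W` is a tempered distribution `T`: the distribution that `W` defines on test functions is the
restriction of `T`. -/
def RepresentedBy (W : Space d → EReal) (T : 𝓢'(Space d, ℂ)) : Prop :=
  ∀ φ : 𝓢(Space d, ℂ), HasCompactSupport φ → T φ = ∫ x, φ x * ((W x).toReal : ℂ)

/-- The Fourier transform of `W`, in the sense of tempered distributions, is on `ℝ^d \ {0}` the
locally integrable function `w`. -/
structure IsFourierTransformOffZero (W : Space d → EReal) (w : Space d → ℝ) : Prop where
  locallyIntegrableOn : LocallyIntegrableOn w {0}ᶜ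
  fourier_eq : ∃ T : 𝓢'(Space d, ℂ), RepresentedBy W T ∧
    ∀ φ : 𝓢(Space d, ℂ), HasCompactSupport φ → (0 : Space d) ∉ tsupport φ →
      (𝓕 T) φ = ∫ ξ, φ ξ * (w ξ : ℂ)

/-- The potential `W` is Fourier representable at level `k`: `W` satisfies the standing assumption,
its Fourier transform is a locally integrable function `w` on `ℝ^d \ {0}` (determined almost
everywhere by `W`), and `E[μ] = ½ ∫_{ℝ^d \ {0}} w |μ̂|²`, the integral being absolutely convergent,
for every compactly supported signed measure `μ` with `E[|μ|] < ∞` whose moments of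
order `0, …, k - 1` vanish. -/
def FourierRepresentable (k : ℕ) (W : Space d → EReal) : Prop :=
  IsPotential W ∧ ∃ w : Space d → ℝ, IsFourierTransformOffZero W w ∧
    ∀ μ : SignedMeasure (Space d), CompactlySupported μ → energy W μ.totalVariation < ⊤ →
      (∀ j < k, MomentVanishes μ j) →
        IntegrableOn (fun ξ => w ξ * ‖fourierSigned μ ξ‖ ^ 2) {0}ᶜ ∧
        signedEnergy W μ = (1 / 2) * ∫ ξ in {0}ᶜ, w ξ * ‖fourierSigned μ ξ‖ ^ 2

end InteractionEnergy

end

/-! Up to constant multiples and linear combinations, every power-law kernel here is either a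
quadratic or a superposition over t > 0 of Gaussians exp(-t|x|²), each corrected by a quadratic α +
β|x|² chosen so that the t-integral converges. For a single Gaussian the energy identity is Fubini
(`integral_gaussian_energy`), with the positive transform `gaussHat t`. The corrections do not
contribute: against μ ⊗ μ the constant is killed by vanishing mass, and |x - y|² by vanishing mass
and first moments (`quadratic_energy`). This is where the levels 0, 1, 2 come from. Against the
transform of a test function vanishing near the origin every quadratic integrates to zero
(`gaussPair_testFunction`), so the same computation identifies the Fourier transform of W off the
origin. `GaussPair` abstracts the two situations, and `Represents` records that a kernel satisfies
the resulting identity for all such pairs with nonnegative dual side.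

The delicate point, in `represents_mixture`, is integrating over t on the Fourier side, where
nothing shows the cancellation produced by the corrections. Since `gaussHat t` and h are
nonnegative, the ξ-integral of the absolute value at fixed t equals the absolute value of the
corrected x-integral at t. That is integrable in t as soon as the x-side converges absolutely, which
a dominating kernel κ guarantees. Complex test functions are reduced to nonnegative ones in
`fourier_test`.

The weight t^(-b/2-1) produces |x|^b by scaling, with corrected Gaussian Φ(t|x|²), where Φ(s) is
exp(-s), exp(-s) - 1 or exp(-s) - 1 + s for b < 0, 0 < b < 2, 2 < b < 4. An extra factor log t
produces |x|^b log|x| (`represents_of_profile`). At b = 0 and b = 2 these profiles fail; log|x| and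
|x|² log|x| come from Frullani integrals instead, and |x|² is itself a quadratic.

Finally, finite energy of |μ| must control κ. Near the origin the positive part of W dominates κ up
to a constant, which is checked for radial kernels in `fourierRepresentable_radial`; for the
attractive-repulsive potential with b ≤ 0, the term with exponent b is the more singular one. -/

noncomputable section

namespace InteractionEnergy

variable {d : ℕ}

/-! ### Signed measures as ±1 densities against their total variation -/

section SignDensity

variable {X : Type*} [MeasurableSpace X]

/-- The positive set of a Hahn decomposition of `μ` adapted to its Jordan decomposition. -/
def hahnSet (μ : SignedMeasure X) : Set X := μ.toJordanDecomposition_spec.choose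

/-- The density `±1` of a signed measure with respect to its total variation. -/
def signDensity (μ : SignedMeasure X) : X → ℝ :=
  fun x => (hahnSet μ).indicator (fun _ => (1 : ℝ)) x - (hahnSet μ)ᶜ.indicator (fun _ => (1 : ℝ)) x

lemma measurableSet_hahnSet (μ : SignedMeasure X) : MeasurableSet (hahnSet μ) :=
  μ.toJordanDecomposition_spec.choose_spec.choose

lemma measurable_signDensity (μ : SignedMeasure X) : Measurable (signDensity μ) :=
  (measurable_const.indicator (measurableSet_hahnSet μ)).sub
    (measurable_const.indicator (measurableSet_hahnSet μ).compl)

lemma abs_signDensity (μ : SignedMeasure X) (x : X) : |signDensity μ x| = 1 := by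
  by_cases hx : x ∈ hahnSet μ <;> simp [signDensity, hx]

lemma posPart_compl_hahnSet (μ : SignedMeasure X) :
    μ.toJordanDecomposition.posPart (hahnSet μ)ᶜ = 0 := by
  obtain ⟨h1, h2, h3, h4, h5⟩ := μ.toJordanDecomposition_spec.choose_spec
  rw [h4, SignedMeasure.toMeasureOfZeroLE_apply _ _ _ (measurableSet_hahnSet μ).compl]
  simp [hahnSet]

lemma negPart_hahnSet (μ : SignedMeasure X) :
    μ.toJordanDecomposition.negPart (hahnSet μ) = 0 := by
  obtain ⟨h1, h2, h3, h4, h5⟩ := μ.toJordanDecomposition_spec.choose_spec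
  rw [h5, SignedMeasure.toMeasureOfLEZero_apply _ _ _ (measurableSet_hahnSet μ)]
  simp [hahnSet]

instance isFiniteMeasure_totalVariation (μ : SignedMeasure X) :
    IsFiniteMeasure μ.totalVariation := by
  unfold SignedMeasure.totalVariation; infer_instance

variable {G : Type*} [NormedAddCommGroup G] [NormedSpace ℝ G]

/-- The density is 1 almost everywhere for the positive part and -1 for the negative part. No
integrability is assumed: multiplying by a function of modulus one does not affect it, so otherwise
both sides are the default value 0. -/
theorem integral_signedMeasure_eq (μ : SignedMeasure X) (f : X → G) :
    ∫ᵛ x, f x ∂<•μ = ∫ x, signDensity μ x • f x ∂μ.totalVariation := by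
  by_cases hf : Integrable f μ.totalVariation
  · have hp : Integrable f μ.toJordanDecomposition.posPart := by
      refine hf.mono_measure ?_
      exact Measure.le_add_right le_rfl
    have hn : Integrable f μ.toJordanDecomposition.negPart := by
      refine hf.mono_measure ?_
      exact Measure.le_add_left le_rfl
    have hsf : Integrable (fun x => signDensity μ x • f x) μ.totalVariation := by
      refine hf.norm.mono ?_ (Filter.Eventually.of_forall fun x => ?_)
      · exact (measurable_signDensity μ).aestronglyMeasurable.smul hf.1
      · simp [norm_smul, abs_signDensity]
    have hsp : Integrable (fun x => signDensity μ x • f x) μ.toJordanDecomposition.posPart := by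
      refine hsf.mono_measure ?_
      exact Measure.le_add_right le_rfl
    have hsn : Integrable (fun x => signDensity μ x • f x) μ.toJordanDecomposition.negPart := by
      refine hsf.mono_measure ?_
      exact Measure.le_add_left le_rfl
    have e1 : ∫ x, signDensity μ x • f x ∂μ.toJordanDecomposition.posPart
        = ∫ x, f x ∂μ.toJordanDecomposition.posPart := by
      refine integral_congr_ae ?_
      have : ∀ᵐ x ∂μ.toJordanDecomposition.posPart, x ∈ hahnSet μ := by
        rw [ae_iff]; exact posPart_compl_hahnSet μ
      filter_upwards [this] with x hx
      simp [signDensity, hx]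
    have e2 : ∫ x, signDensity μ x • f x ∂μ.toJordanDecomposition.negPart
        = - ∫ x, f x ∂μ.toJordanDecomposition.negPart := by
      rw [← integral_neg]
      refine integral_congr_ae ?_
      have : ∀ᵐ x ∂μ.toJordanDecomposition.negPart, x ∉ hahnSet μ := by
        rw [ae_iff]; simpa using negPart_hahnSet μ
      filter_upwards [this] with x hx
      simp [signDensity, hx]
    have e3 : ∫ x, signDensity μ x • f x ∂μ.totalVariation = 
        ∫ x, f x ∂μ.toJordanDecomposition.posPart - ∫ x, f x ∂μ.toJordanDecomposition.negPart := by
      rw [SignedMeasure.totalVariation, integral_add_measure hsp hsn, e1, e2, sub_eq_add_neg]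
    rw [e3]
    conv_lhs => rw [← μ.toSignedMeasure_toJordanDecomposition]
    rw [JordanDecomposition.toSignedMeasure, VectorMeasure.integral_sub_vectorMeasure,
      VectorMeasure.integral_toSignedMeasure, VectorMeasure.integral_toSignedMeasure]
    · simpa [VectorMeasure.Integrable] using hp
    · simpa [VectorMeasure.Integrable] using hn
  · rw [VectorMeasure.integral_undef]
    · rw [integral_undef]
      contrapose! hf
      have h2 : Integrable (fun x => signDensity μ x • signDensity μ x • f x)
          μ.totalVariation := by
        refine hf.norm.mono ?_ (Filter.Eventually.of_forall fun x => ?_)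
        · exact (measurable_signDensity μ).aestronglyMeasurable.smul hf.1
        · simp [norm_smul, abs_signDensity]
      refine h2.congr (Filter.Eventually.of_forall fun x => ?_)
      simp only [smul_smul]
      have := abs_signDensity μ x
      rw [← abs_mul_abs_self, this]; simp
    · rwa [VectorMeasure.Integrable, ← SignedMeasure.totalVariation_eq_variation]

end SignDensity

/-! ### Gaussians and their Fourier transforms -/

/-- The Fourier transform of `x ↦ exp (-t |x|²)`. -/
def gaussHat (t : ℝ) (ξ : Space d) : ℝ :=
  (Real.pi / t) ^ ((d : ℝ) / 2) * Real.exp (-(Real.pi ^ 2 / t) * ‖ξ‖ ^ 2)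

lemma gaussHat_nonneg {t : ℝ} (ht : 0 ≤ t) (ξ : Space d) : 0 ≤ gaussHat t ξ := by
  unfold gaussHat; positivity

lemma measurable_gaussHat_uncurry : Measurable fun p : ℝ × Space d => gaussHat p.1 p.2 := by
  unfold gaussHat; fun_prop

lemma integrable_gaussHat {t : ℝ} (ht : 0 < t) : Integrable (gaussHat t : Space d → ℝ) := by
  have h := (GaussianFourier.integrable_cexp_neg_mul_sq_norm_add (V := Space d)
    (b := ((Real.pi ^ 2 / t : ℝ) : ℂ)) (by rw [Complex.ofReal_re]; positivity) 0 0).norm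
  refine Integrable.const_mul (h.congr (Filter.Eventually.of_forall fun ξ => ?_)) _
  simp [Complex.norm_exp, ← Complex.ofReal_pow]

lemma fourier_gaussian_eq_gaussHat {t : ℝ} (ht : 0 < t) (ξ : Space d) :
    𝓕 (fun x : Space d => Complex.exp (-(t : ℂ) * ‖x‖ ^ 2)) ξ = gaussHat t ξ := by
  rw [fourier_gaussian_innerProductSpace (by simpa using ht)]
  unfold gaussHat
  push_cast
  rw [Complex.ofReal_cpow (by positivity)]
  push_cast
  simp only [finrank_euclideanSpace, Fintype.card_fin]
  ring_nf

/-- Fourier inversion for Gaussians, obtained by transforming the Gaussian of parameter π²/t: the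
prefactors (π/t)^(d/2) and (t/π)^(d/2) cancel. -/
lemma integral_gaussHat_mul_exp {t : ℝ} (ht : 0 < t) (z : Space d) :
    ∫ ξ : Space d, (gaussHat t ξ : ℂ) * Complex.exp (-2 * Real.pi * Complex.I * (inner ℝ z ξ : ℝ))
      = (Real.exp (-t * ‖z‖ ^ 2) : ℂ) := by
  have h := fourier_gaussian_innerProductSpace (V := Space d) (b := ((Real.pi ^ 2 / t : ℝ) : ℂ))
    (by rw [Complex.ofReal_re]; positivity) z
  rw [Real.fourier_eq'] at h
  have h2 : ∀ ξ : Space d, (gaussHat t ξ : ℂ) *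
      Complex.exp (-2 * Real.pi * Complex.I * (inner ℝ z ξ : ℝ)) =
      ((Real.pi / t) ^ ((d : ℝ) / 2) : ℝ) *
      (Complex.exp (↑(-2 * Real.pi * inner ℝ ξ z) * Complex.I) •
        Complex.exp (-((Real.pi ^ 2 / t : ℝ) : ℂ) * ‖ξ‖ ^ 2)) := by
    intro ξ
    rw [real_inner_comm, gaussHat, smul_eq_mul]
    push_cast
    rw [mul_assoc, mul_comm (Complex.exp (_ * (‖ξ‖ : ℂ) ^ 2))]
    congr 3
    ring
  simp_rw [h2]
  rw [integral_const_mul, h, ← mul_assoc]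
  simp only [finrank_euclideanSpace, Fintype.card_fin]
  have h3 : ((Real.pi : ℂ) / ((Real.pi ^ 2 / t : ℝ) : ℂ)) ^ ((d : ℂ) / 2) =
      (((t / Real.pi) ^ ((d : ℝ) / 2) : ℝ) : ℂ) := by
    rw [Complex.ofReal_cpow (by positivity)]
    push_cast
    congr 1
    have : (Real.pi : ℂ) ≠ 0 := by exact_mod_cast Real.pi_ne_zero
    have : (t : ℂ) ≠ 0 := by exact_mod_cast ht.ne'
    field_simp
  rw [h3, ← Complex.ofReal_mul, ← Real.mul_rpow (by positivity) (by positivity)]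
  have h4 : Real.pi / t * (t / Real.pi) = 1 := by field_simp
  rw [h4, Real.one_rpow, Complex.ofReal_one, one_mul, Complex.ofReal_exp]
  congr 1
  have : (Real.pi : ℂ) ≠ 0 := by exact_mod_cast Real.pi_ne_zero
  have : (t : ℂ) ≠ 0 := by exact_mod_cast ht.ne'
  push_cast
  field_simp

/-- Self-adjointness of the Fourier transform moves it from φ to the Gaussian. -/
theorem integral_gaussian_mul_fourier {t : ℝ} (ht : 0 < t) (φ : 𝓢(Space d, ℂ)) :
    ∫ x : Space d, (Real.exp (-t * ‖x‖ ^ 2) : ℂ) * (𝓕 φ) x = ∫ ξ, (gaussHat t ξ : ℂ) * φ ξ := by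
  have hg : Integrable (fun x : Space d => Complex.exp (-(t : ℂ) * ‖x‖ ^ 2)) := by
    have h := GaussianFourier.integrable_cexp_neg_mul_sq_norm_add (V := Space d)
      (b := (t : ℂ)) (by simpa using ht) 0 0
    simpa using h
  have h := VectorFourier.integral_fourierIntegral_smul_eq_flip (L := innerₗ (Space d))
    Real.continuous_fourierChar continuous_inner (φ.integrable (μ := volume)) hg
  rw [flip_innerₗ] at h
  have e : ∀ ξ : Space d, (gaussHat t ξ : ℂ) * φ ξ =
      φ ξ • 𝓕 (fun x : Space d => Complex.exp (-(t : ℂ) * ‖x‖ ^ 2)) ξ := by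
    intro ξ
    rw [fourier_gaussian_eq_gaussHat ht, smul_eq_mul, mul_comm]
  simp_rw [e]
  refine Eq.trans ?_ h
  refine integral_congr_ae (Filter.Eventually.of_forall fun x => ?_)
  simp only [smul_eq_mul, SchwartzMap.fourier_coe]
  rw [mul_comm]
  congr 1
  push_cast
  rfl

/-! ### Gaussian energies of a density -/

/-- The Fourier transform of the measure with density `s` with respect to `ρ`. -/
def fourierDensity (ρ : Measure (Space d)) (s : Space d → ℝ) (ξ : Space d) : ℂ :=
  ∫ x, (s x : ℂ) * Complex.exp (-2 * Real.pi * Complex.I * (inner ℝ x ξ : ℝ)) ∂ρ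

lemma norm_exp_inner (x ξ : Space d) :
    ‖Complex.exp (-2 * Real.pi * Complex.I * (inner ℝ x ξ : ℝ))‖ = 1 := by
  rw [Complex.norm_exp]
  simp

section Density

variable {ρ : Measure (Space d)} [IsFiniteMeasure ρ] {s : Space d → ℝ}

lemma integrable_density (hs : Measurable s) (hs1 : ∀ x, |s x| ≤ 1) : Integrable s ρ :=
  Integrable.of_bound hs.aestronglyMeasurable 1 (Filter.Eventually.of_forall hs1)

lemma continuous_fourierDensity (hs : Measurable s) (hs1 : ∀ x, |s x| ≤ 1) :
    Continuous (fourierDensity ρ s) := by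
  unfold fourierDensity
  refine continuous_of_dominated (bound := fun _ => 1) ?_ ?_ (integrable_const _) ?_
  · intro ξ; fun_prop
  · intro ξ
    refine Filter.Eventually.of_forall fun x => ?_
    rw [norm_mul, norm_exp_inner, mul_one]
    simpa using hs1 x
  · refine Filter.Eventually.of_forall fun x => ?_
    fun_prop

lemma norm_fourierDensity_le (hs1 : ∀ x, |s x| ≤ 1) (ξ : Space d) :
    ‖fourierDensity ρ s ξ‖ ≤ ρ.real Set.univ := by
  refine (norm_integral_le_of_norm_le_const (C := 1)
    (Filter.Eventually.of_forall fun x => ?_)).trans (by simp)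
  rw [norm_mul, norm_exp_inner, mul_one]
  simpa using hs1 x

lemma integrable_gaussHat_mul_norm_sq (hs : Measurable s) (hs1 : ∀ x, |s x| ≤ 1) {t : ℝ}
    (ht : 0 < t) : Integrable (fun ξ : Space d => gaussHat t ξ * ‖fourierDensity ρ s ξ‖ ^ 2) := by
  refine (integrable_gaussHat ht).mul_bdd (c := (ρ.real Set.univ) ^ 2)
    ((continuous_fourierDensity hs hs1).norm.pow 2).aestronglyMeasurable
    (Filter.Eventually.of_forall fun ξ => ?_)
  rw [norm_pow, norm_norm]
  gcongr
  exact norm_fourierDensity_le hs1 ξ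

/-- The Gaussian in x - y is written as the Fourier integral of `gaussHat t`. After exchanging
integrals, the phase splits and the double integral at fixed ξ is the transform times its conjugate.
-/
theorem integral_gaussian_energy (hs : Measurable s) (hs1 : ∀ x, |s x| ≤ 1) {t : ℝ}
    (ht : 0 < t) :
    ∫ z : Space d × Space d, (Real.exp (-t * ‖z.1 - z.2‖ ^ 2) : ℂ) * ((s z.1 * s z.2 : ℝ) : ℂ)
      ∂(ρ.prod ρ) = ∫ ξ, (gaussHat t ξ : ℂ) * ((‖fourierDensity ρ s ξ‖ ^ 2 : ℝ) : ℂ) := by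
  simp_rw [← integral_gaussHat_mul_exp ht, ← integral_mul_const]
  rw [integral_integral_swap]
  · refine integral_congr_ae (Filter.Eventually.of_forall fun ξ => ?_)
    simp only [mul_assoc]
    rw [integral_const_mul]
    congr 1
    have e : ∀ z : Space d × Space d,
        Complex.exp (-2 * (Real.pi * (Complex.I * (inner ℝ (z.1 - z.2) ξ : ℝ)))) *
          ((s z.1 * s z.2 : ℝ) : ℂ) =
        ((s z.1 : ℂ) * Complex.exp (-2 * Real.pi * Complex.I * (inner ℝ z.1 ξ : ℝ))) *
        (starRingEnd ℂ)
          ((s z.2 : ℂ) * Complex.exp (-2 * Real.pi * Complex.I * (inner ℝ z.2 ξ : ℝ))) := by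
      intro z
      rw [map_mul, ← Complex.exp_conj, Complex.conj_ofReal, inner_sub_left]
      simp only [map_mul, map_neg, Complex.conj_ofReal, Complex.conj_I]
      rw [show (starRingEnd ℂ) (2 : ℂ) = 2 from Complex.conj_ofReal 2]
      push_cast
      rw [show (-2 * (Real.pi * (Complex.I * ((inner ℝ z.1 ξ : ℝ) - (inner ℝ z.2 ξ : ℝ)))) : ℂ) =
        -2 * Real.pi * Complex.I * (inner ℝ z.1 ξ : ℝ) +
          -2 * Real.pi * -Complex.I * (inner ℝ z.2 ξ : ℝ) by ring, Complex.exp_add]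
      ring
    simp_rw [e]
    rw [integral_prod_mul (μ := ρ) (ν := ρ)
      (fun x => (s x : ℂ) * Complex.exp (-2 * Real.pi * Complex.I * (inner ℝ x ξ : ℝ)))
      (fun x => (starRingEnd ℂ)
        ((s x : ℂ) * Complex.exp (-2 * Real.pi * Complex.I * (inner ℝ x ξ : ℝ)))),
      integral_conj, ← fourierDensity, Complex.mul_conj']
    push_cast; rfl
  · have hp : Integrable (fun p : (Space d × Space d) × Space d =>
        ((s p.1.1 * s p.1.2 : ℝ) : ℂ) * (gaussHat t p.2 : ℂ)) ((ρ.prod ρ).prod volume) :=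
      Integrable.mul_prod (((integrable_density hs hs1).mul_prod (integrable_density hs hs1)).ofReal)
        (integrable_gaussHat ht).ofReal
    refine hp.mono ?_ (Filter.Eventually.of_forall fun p => ?_)
    · have := measurable_gaussHat_uncurry (d := d)
      have h2 : Measurable (gaussHat t : Space d → ℝ) := by
        exact this.comp (measurable_const.prodMk measurable_id)
      simp only [Function.uncurry_def]
      refine Measurable.aestronglyMeasurable ?_
      fun_prop
    · simp only [Function.uncurry_def, norm_mul, norm_exp_inner]
      rw [mul_one, mul_comm]

end Density

/-! ### Gauss pairs from test functions and from energies -/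

/-- A quadratic `α + β |x|²` all of whose terms have degree less than `2 * k`, for `k ≤ 2`. -/
def AdmissibleQuadratic (k : ℕ) (α β : ℝ) : Prop := (k = 0 → α = 0) ∧ (k ≤ 1 → β = 0)

/-- `h` is the Fourier side of `g`: integrals of Gaussians against the image of `g dν` under `u` are
integrals of their Fourier transforms against `h`, and quadratics admissible at level `k` are
annihilated. -/
structure GaussPair (k : ℕ) {X : Type} [MeasurableSpace X] (ν : Measure X) (u : X → Space d)
    (g : X → ℂ) (h : Space d → ℂ) : Prop where
  measurable_map : Measurable u
  measurable_dual : Measurable h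
  integrable : Integrable g ν
  quadratic : ∀ α β : ℝ, AdmissibleQuadratic k α β →
    Integrable (fun x => ((α + β * ‖u x‖ ^ 2 : ℝ) : ℂ) * g x) ν ∧
      ∫ x, ((α + β * ‖u x‖ ^ 2 : ℝ) : ℂ) * g x ∂ν = 0
  gaussian : ∀ t : ℝ, 0 < t → Integrable (fun ξ => (gaussHat t ξ : ℂ) * h ξ) ∧
    ∫ x, (Real.exp (-t * ‖u x‖ ^ 2) : ℂ) * g x ∂ν = ∫ ξ, (gaussHat t ξ : ℂ) * h ξ

lemma AdmissibleQuadratic.mono {k k' : ℕ} (hk : k ≤ k') {α β : ℝ}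
    (h : AdmissibleQuadratic k α β) : AdmissibleQuadratic k' α β :=
  ⟨fun h0 => h.1 (by omega), fun h1 => h.2 (by omega)⟩

lemma GaussPair.mono {k k' : ℕ} (hk : k ≤ k') {X : Type} [MeasurableSpace X] {ν : Measure X}
    {u : X → Space d} {g : X → ℂ} {h : Space d → ℂ} (H : GaussPair k' ν u g h) :
    GaussPair k ν u g h where
  measurable_map := H.measurable_map
  measurable_dual := H.measurable_dual
  integrable := H.integrable
  quadratic := fun α β hq => H.quadratic α β (hq.mono hk)
  gaussian := H.gaussian

section TestFunction

variable {φ : 𝓢(Space d, ℂ)}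

lemma integral_fourier_eq_apply_zero (φ : 𝓢(Space d, ℂ)) : ∫ x, (𝓕 φ) x = φ 0 := by
  have h : 𝓕⁻ (𝓕 φ) 0 = φ 0 := by rw [FourierTransform.fourierInv_fourier_eq]
  rw [← h, SchwartzMap.fourierInv_coe, Real.fourierInv_eq']
  simp

-- Multiplication by the square of a linear form is, up to the factor (2πi)², the transform of a
-- second directional derivative. The integral is therefore that derivative evaluated at 0, which is
-- outside the support.
open LineDeriv in
lemma integral_inner_sq_mul_fourier (φ : 𝓢(Space d, ℂ)) (hφ : (0 : Space d) ∉ tsupport φ)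
    (m : Space d) :
    Integrable (fun x => ((inner ℝ x m ^ 2 : ℝ) : ℂ) * (𝓕 φ) x) ∧
      ∫ x, ((inner ℝ x m ^ 2 : ℝ) : ℂ) * (𝓕 φ) x = 0 := by
  have h0 : (∂_{m} (∂_{m} φ) : 𝓢(Space d, ℂ)) 0 = 0 := by
    refine image_eq_zero_of_notMem_tsupport fun h => hφ ?_
    exact SchwartzMap.tsupport_lineDerivOp_subset m _
      (SchwartzMap.tsupport_lineDerivOp_subset m _ h)
  have hm : (fun x : Space d => inner ℝ x m).HasTemperateGrowth := by fun_prop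
  have e : ∀ x, (𝓕 (∂_{m} (∂_{m} φ)) : 𝓢(Space d, ℂ)) x =
      (2 * Real.pi * Complex.I) ^ 2 * (((inner ℝ x m ^ 2 : ℝ) : ℂ) * (𝓕 φ) x) := by
    intro x
    rw [SchwartzMap.fourier_lineDerivOp_eq, SchwartzMap.fourier_lineDerivOp_eq]
    simp only [_root_.smul_apply, SchwartzMap.smulLeftCLM_apply_apply hm, smul_eq_mul,
      Complex.real_smul]
    push_cast
    ring
  have hc : (2 * Real.pi * Complex.I) ^ 2 ≠ 0 := by
    simp [Real.pi_ne_zero]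
  constructor
  · have hi := ((𝓕 (∂_{m} (∂_{m} φ)) : 𝓢(Space d, ℂ)).integrable (μ := volume)).const_mul
      ((2 * Real.pi * Complex.I) ^ 2)⁻¹
    refine hi.congr (Filter.Eventually.of_forall fun x => ?_)
    simp only [e]
    rw [inv_mul_cancel_left₀ hc]
  · have h1 := integral_fourier_eq_apply_zero (∂_{m} (∂_{m} φ))
    rw [h0] at h1
    simp_rw [e] at h1
    rw [integral_const_mul] at h1
    exact (mul_eq_zero.1 h1).resolve_left hc

/-- A quadratic paired with the transform of φ sees only φ and its second derivatives at 0. All of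
these vanish, so every level k is allowed. -/
theorem gaussPair_testFunction (k : ℕ) (φ : 𝓢(Space d, ℂ)) (hφ : (0 : Space d) ∉ tsupport φ) :
    GaussPair k (volume : Measure (Space d)) id (⇑(𝓕 φ : 𝓢(Space d, ℂ))) φ where
  measurable_map := measurable_id
  measurable_dual := φ.continuous.measurable
  integrable := (𝓕 φ).integrable
  quadratic := by
    intro α β _
    have e : ∀ x : Space d, ((α + β * ‖id x‖ ^ 2 : ℝ) : ℂ) * (𝓕 φ) x = α * (𝓕 φ) x +
        β * ∑ i, ((inner ℝ x (EuclideanSpace.basisFun (Fin d) ℝ i) ^ 2 : ℝ) : ℂ) * (𝓕 φ) x := by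
      intro x
      rw [← Finset.sum_mul, ← Complex.ofReal_sum,
        (EuclideanSpace.basisFun (Fin d) ℝ).sum_sq_inner_left x]
      simp only [id]
      push_cast
      ring
    simp_rw [e]
    have i1 := ((𝓕 φ).integrable (μ := volume)).const_mul (α : ℂ)
    have i2 := integrable_finsetSum Finset.univ fun (i : Fin d) _ =>
      (integral_inner_sq_mul_fourier φ hφ (EuclideanSpace.basisFun (Fin d) ℝ i)).1
    refine ⟨i1.add (i2.const_mul _), ?_⟩
    rw [integral_add i1 (i2.const_mul _), integral_const_mul, integral_const_mul,
      integral_fourier_eq_apply_zero, image_eq_zero_of_notMem_tsupport hφ, integral_finsetSum]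
    · rw [Finset.sum_eq_zero fun i _ =>
        (integral_inner_sq_mul_fourier φ hφ (EuclideanSpace.basisFun (Fin d) ℝ i)).2]
      simp
    · exact fun (i : Fin d) _ =>
        (integral_inner_sq_mul_fourier φ hφ (EuclideanSpace.basisFun (Fin d) ℝ i)).1
  gaussian := by
    intro t ht
    refine ⟨?_, integral_gaussian_mul_fourier ht φ⟩
    obtain ⟨C, hC⟩ := φ.toBoundedContinuousFunction.bddAbove_range_norm_comp 
    refine (integrable_gaussHat ht).ofReal.mul_bdd (c := C) φ.continuous.aestronglyMeasurable
      (Filter.Eventually.of_forall fun ξ => ?_)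
    exact hC ⟨ξ, rfl⟩

end TestFunction

section Density

/-- The moments of order `j` of the measure with density `s` with respect to `ρ` vanish. -/
def DensityMomentVanishes (ρ : Measure (Space d)) (s : Space d → ℝ) (j : ℕ) : Prop :=
  ∀ i : Fin j → Fin d, ∫ x, s x * ∏ l, x (i l) ∂ρ = 0

variable {ρ : Measure (Space d)} [IsFiniteMeasure ρ] {s : Space d → ℝ}

lemma integrable_mul_density (hs : Measurable s) (hs1 : ∀ x, |s x| ≤ 1) {K : Set (Space d)}
    (hK : IsCompact K) (hρ : ρ Kᶜ = 0) {f : Space d → ℝ} (hf : Continuous f) :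
    Integrable (fun x => s x * f x) ρ := by
  obtain ⟨C, hC⟩ := hK.exists_bound_of_continuousOn hf.continuousOn
  refine Integrable.of_bound (hs.aestronglyMeasurable.mul hf.aestronglyMeasurable) C ?_
  have : ∀ᵐ x ∂ρ, x ∈ K := by rw [ae_iff]; exact hρ
  filter_upwards [this] with x hx
  rw [norm_mul]
  calc _ ≤ 1 * ‖f x‖ := by gcongr; exact hs1 x
    _ ≤ C := by rw [one_mul]; exact hC x hx

lemma norm_sub_sq_eq_sum (x y : Space d) :
    ‖x - y‖ ^ 2 = ‖x‖ ^ 2 + ‖y‖ ^ 2 - 2 * ∑ i, x i * y i := by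
  rw [norm_sub_sq_real, PiLp.inner_apply]
  simp only [RCLike.inner_apply, conj_trivial]
  simp_rw [mul_comm]
  ring

/-- Expanding |x - y|² leaves the squared mass, the mass times the second moment (twice), and the
squared first moments. Zero mass kills all but the last, and level 2 also kills the last; second
moments themselves need not vanish. -/
theorem quadratic_energy (hs : Measurable s) (hs1 : ∀ x, |s x| ≤ 1) {K : Set (Space d)}
    (hK : IsCompact K) (hρ : ρ Kᶜ = 0) {k : ℕ} (hm : ∀ j < k, DensityMomentVanishes ρ s j)
    {α β : ℝ} (hq : AdmissibleQuadratic k α β) :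
    Integrable (fun z : Space d × Space d => (α + β * ‖z.1 - z.2‖ ^ 2) * (s z.1 * s z.2))
      (ρ.prod ρ) ∧
    ∫ z : Space d × Space d, (α + β * ‖z.1 - z.2‖ ^ 2) * (s z.1 * s z.2) ∂(ρ.prod ρ) = 0 := by
  have I0 : Integrable s ρ := integrable_density hs hs1
  have I2 : Integrable (fun x => s x * ‖x‖ ^ 2) ρ :=
    integrable_mul_density hs hs1 hK hρ (by fun_prop)
  have I1 : ∀ i, Integrable (fun x => s x * x i) ρ := fun i =>
    integrable_mul_density hs hs1 hK hρ (by fun_prop)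
  have M0 : 0 < k → ∫ x, s x ∂ρ = 0 := fun h => by simpa using hm 0 h Fin.elim0
  have M1 : 1 < k → ∀ i, ∫ x, s x * x i ∂ρ = 0 := fun h i => by simpa using hm 1 h fun _ => i
  have e : ∀ z : Space d × Space d, (α + β * ‖z.1 - z.2‖ ^ 2) * (s z.1 * s z.2) =
      α * (s z.1 * s z.2) + (β * ((s z.1 * ‖z.1‖ ^ 2) * s z.2) +
      (β * (s z.1 * (s z.2 * ‖z.2‖ ^ 2)) + 
        -2 * β * ∑ i, (s z.1 * z.1 i) * (s z.2 * z.2 i))) := by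
    intro z
    rw [norm_sub_sq_eq_sum]
    have : ∑ i, (s z.1 * z.1 i) * (s z.2 * z.2 i) = s z.1 * s z.2 * ∑ i, z.1 i * z.2 i := by
      rw [Finset.mul_sum]; exact Finset.sum_congr rfl fun i _ => by ring
    rw [this]; ring
  simp_rw [e]
  have J1 := (I0.mul_prod I0).const_mul α
  have J2 := (I2.mul_prod I0).const_mul β
  have J3 := (I0.mul_prod I2).const_mul β
  have J4' := fun (i : Fin d) (_ : i ∈ Finset.univ) => (I1 i).mul_prod (I1 i)
  have J4 := (integrable_finsetSum Finset.univ J4').const_mul (-2 * β)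
  refine ⟨J1.add (J2.add (J3.add J4)), ?_⟩
  rw [integral_add J1 (J2.fun_add (J3.fun_add J4)), integral_add J2 (J3.fun_add J4),
    integral_add J3 J4,
    integral_const_mul, integral_const_mul, integral_const_mul, integral_const_mul,
    integral_finsetSum _ J4', integral_prod_mul (μ := ρ) (ν := ρ) s s,
    integral_prod_mul (μ := ρ) (ν := ρ) (fun x => s x * ‖x‖ ^ 2) s,
    integral_prod_mul (μ := ρ) (ν := ρ) s (fun x => s x * ‖x‖ ^ 2)]
  have e4 : ∀ i : Fin d, ∫ z : Space d × Space d, (s z.1 * z.1 i) * (s z.2 * z.2 i) ∂(ρ.prod ρ) =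
      (∫ x, s x * x i ∂ρ) * ∫ x, s x * x i ∂ρ := fun i =>
    integral_prod_mul (μ := ρ) (ν := ρ) (fun x => s x * x i) (fun x => s x * x i)
  simp_rw [e4]
  rcases Nat.lt_or_ge 0 k with h0 | h0
  · rw [M0 h0]
    rcases Nat.lt_or_ge 1 k with h1 | h1
    · simp [M1 h1]
    · simp [hq.2 h1]
  · simp [hq.1 (by omega), hq.2 (by omega)]

theorem gaussPair_energy (hs : Measurable s) (hs1 : ∀ x, |s x| ≤ 1) {K : Set (Space d)}
    (hK : IsCompact K) (hρ : ρ Kᶜ = 0) {k : ℕ} (hm : ∀ j < k, DensityMomentVanishes ρ s j) :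
    GaussPair k (ρ.prod ρ) (fun z => z.1 - z.2) (fun z => ((s z.1 * s z.2 : ℝ) : ℂ))
      (fun ξ => ((‖fourierDensity ρ s ξ‖ ^ 2 : ℝ) : ℂ)) where
  measurable_map := by fun_prop
  measurable_dual := by
    have := (continuous_fourierDensity (ρ := ρ) hs hs1).measurable
    fun_prop
  integrable := ((integrable_density hs hs1).mul_prod (integrable_density hs hs1)).ofReal
  quadratic := by
    intro α β hq
    obtain ⟨h1, h2⟩ := quadratic_energy hs hs1 hK hρ hm hq
    refine ⟨?_, ?_⟩
    · refine h1.ofReal.congr (Filter.Eventually.of_forall fun z => ?_)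
      push_cast; rfl
    · rw [← Complex.ofReal_zero, ← h2, ← integral_complex_ofReal]
      refine integral_congr_ae (Filter.Eventually.of_forall fun z => ?_)
      push_cast; rfl
  gaussian := by
    intro t ht
    refine ⟨?_, integral_gaussian_energy hs hs1 ht⟩
    refine (integrable_gaussHat_mul_norm_sq (ρ := ρ) hs hs1 ht).ofReal.congr
      (Filter.Eventually.of_forall fun z => ?_)
    push_cast; rfl

end Density

/-! ### Calculus of kernels represented on the Fourier side -/

/-- `w` represents the kernel `V` on the Fourier side at level `k`: `∫ V(u) g dν = ∫ w h` for every
Gauss pair `(g, h)` with `h ≥ 0` for which the dominating kernel `κ` is integrable. -/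
structure Represents (k : ℕ) (V : Space d → ℝ) (κ : Space d → ENNReal) (w : Space d → ℝ) :
    Prop where
  measurable_kernel : Measurable V
  measurable_bound : Measurable κ
  bound : ∃ C : NNReal, ∀ x, ‖V x‖ₑ ≤ C * κ x
  pairing : ∀ {X : Type} [MeasurableSpace X] (ν : Measure X) [SFinite ν] (u : X → Space d)
    (g : X → ℂ) (h : Space d → ℝ), GaussPair k ν u g (fun ξ => (h ξ : ℂ)) → (∀ ξ, 0 ≤ h ξ) →
    ∫⁻ x, κ (u x) * ‖g x‖ₑ ∂ν < ⊤ →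
      Integrable (fun ξ => w ξ * h ξ) ∧
        ∫ x, (V (u x) : ℂ) * g x ∂ν = ∫ ξ, ((w ξ * h ξ : ℝ) : ℂ)

namespace Represents

variable {k : ℕ} {V V₁ V₂ : Space d → ℝ} {κ κ' : Space d → ENNReal} {w w₁ w₂ : Space d → ℝ}

lemma integrable_kernel (H : Represents k V κ w) {X : Type} [MeasurableSpace X] {ν : Measure X}
    {u : X → Space d} {g : X → ℂ} (hu : Measurable u) (hg : AEStronglyMeasurable g ν)
    (hκ : ∫⁻ x, κ (u x) * ‖g x‖ₑ ∂ν < ⊤) : Integrable (fun x => (V (u x) : ℂ) * g x) ν := by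
  obtain ⟨C, hC⟩ := H.bound
  refine ⟨?_, ?_⟩
  · have := H.measurable_kernel.comp hu
    exact (Complex.measurable_ofReal.comp this).aestronglyMeasurable.mul hg
  · refine lt_of_le_of_lt (lintegral_mono (g := fun x => C * (κ (u x) * ‖g x‖ₑ)) fun x => ?_) ?_
    · simp only [enorm_mul]
      rw [← mul_assoc]
      gcongr
      refine le_trans (le_of_eq ?_) (hC (u x))
      simp [enorm_eq_nnnorm]
    · rw [lintegral_const_mul' _ _ ENNReal.coe_ne_top]
      exact ENNReal.mul_lt_top ENNReal.coe_lt_top hκ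

lemma add (H₁ : Represents k V₁ κ w₁) (H₂ : Represents k V₂ κ w₂) :
    Represents k (fun x => V₁ x + V₂ x) κ (fun ξ => w₁ ξ + w₂ ξ) where
  measurable_kernel := H₁.measurable_kernel.add H₂.measurable_kernel
  measurable_bound := H₁.measurable_bound
  bound := by
    obtain ⟨C₁, h₁⟩ := H₁.bound
    obtain ⟨C₂, h₂⟩ := H₂.bound
    refine ⟨C₁ + C₂, fun x => (enorm_add_le _ _).trans ?_⟩
    rw [ENNReal.coe_add, add_mul]
    exact add_le_add (h₁ x) (h₂ x)
  pairing := by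
    intro X _ ν _ u g h hp h0 hκ
    obtain ⟨i₁, e₁⟩ := H₁.pairing ν u g h hp h0 hκ
    obtain ⟨i₂, e₂⟩ := H₂.pairing ν u g h hp h0 hκ
    have e : ∀ ξ, (w₁ ξ + w₂ ξ) * h ξ = w₁ ξ * h ξ + w₂ ξ * h ξ := fun ξ => by ring
    simp_rw [e]
    refine ⟨i₁.add i₂, ?_⟩
    simp_rw [Complex.ofReal_add, add_mul]
    rw [integral_add (H₁.integrable_kernel hp.measurable_map hp.integrable.1 hκ)
      (H₂.integrable_kernel hp.measurable_map hp.integrable.1 hκ), e₁, e₂]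
    exact (integral_add i₁.ofReal i₂.ofReal).symm

lemma const_mul (H : Represents k V κ w) (c : ℝ) :
    Represents k (fun x => c * V x) κ (fun ξ => c * w ξ) where
  measurable_kernel := H.measurable_kernel.const_mul c
  measurable_bound := H.measurable_bound
  bound := by
    obtain ⟨C, h⟩ := H.bound
    refine ⟨‖c‖₊ * C, fun x => ?_⟩
    rw [enorm_mul, ENNReal.coe_mul, mul_assoc]
    exact mul_le_mul_right (h x) _
  pairing := by
    intro X _ ν _ u g h hp h0 hκ
    obtain ⟨i, e⟩ := H.pairing ν u g h hp h0 hκ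
    simp_rw [mul_assoc, Complex.ofReal_mul c, mul_assoc]
    exact ⟨i.const_mul c, by rw [integral_const_mul, integral_const_mul, e]⟩

lemma mono_level {k' : ℕ} (hk : k ≤ k') (H : Represents k V κ w) : Represents k' V κ w where
  measurable_kernel := H.measurable_kernel
  measurable_bound := H.measurable_bound
  bound := H.bound
  pairing := fun ν _ u g h hp => H.pairing ν u g h (hp.mono hk)

lemma mono_bound (H : Represents k V κ w) (hκ' : Measurable κ') (C : NNReal)
    (hC : ∀ x, κ x ≤ C * κ' x) : Represents k V κ' w where
  measurable_kernel := H.measurable_kernel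
  measurable_bound := hκ'
  bound := by
    obtain ⟨C', h⟩ := H.bound
    refine ⟨C' * C, fun x => (h x).trans ?_⟩
    rw [ENNReal.coe_mul, mul_assoc]
    exact mul_le_mul_right (hC x) _
  pairing := by
    intro X _ ν _ u g h hp h0 hκ
    refine H.pairing ν u g h hp h0 ?_
    refine lt_of_le_of_lt (lintegral_mono (g := fun x => C * (κ' (u x) * ‖g x‖ₑ)) fun x => ?_) ?_
    · simp only [← mul_assoc]
      exact mul_le_mul_left (hC _) _
    · rw [lintegral_const_mul' _ _ ENNReal.coe_ne_top]
      exact ENNReal.mul_lt_top ENNReal.coe_lt_top hκ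

lemma congr_kernel (H : Represents k V₁ κ w) (h : ∀ x, V₁ x = V₂ x) : Represents k V₂ κ w := by
  obtain rfl : V₁ = V₂ := funext h
  exact H

end Represents

/-- The transform of a quadratic lives at the origin, so off the origin its density is zero. -/
lemma represents_quadratic {k : ℕ} {α β : ℝ} (hq : AdmissibleQuadratic k α β)
    {κ : Space d → ENNReal} (hκ : Measurable κ) {C : NNReal}
    (hC : ∀ x, ‖α + β * ‖x‖ ^ 2‖ₑ ≤ C * κ x) :
    Represents k (fun x => α + β * ‖x‖ ^ 2) κ (fun _ => 0) where
  measurable_kernel := by fun_prop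
  measurable_bound := hκ
  bound := ⟨C, hC⟩
  pairing := by
    intro X _ ν _ u g h hp h0 _
    refine ⟨by simp, ?_⟩
    rw [(hp.quadratic α β hq).2]
    simp

/-! ### Mixtures of regularized Gaussians -/

/-- The density of the Gaussian mixture with weight `m`, on the Fourier side. -/
def mixtureHat (m : ℝ → ℝ) (ξ : Space d) : ℝ := ∫ t in Set.Ioi (0 : ℝ), m t * gaussHat t ξ

/-- The regularized Gaussian `exp (-t r²) - (q₀ + q₁ r²)`. -/
def regGauss (q₀ q₁ : ℝ → ℝ) (t r : ℝ) : ℝ := Real.exp (-t * r ^ 2) - (q₀ t + q₁ t * r ^ 2)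

/-- Fubini is applied twice: on the x-side under the bound by κ, and on the ξ-side using positivity.
At each fixed t the quadratic correction drops out and the Gaussian identity applies. -/
theorem represents_mixture {k : ℕ} {m q₀ q₁ : ℝ → ℝ} (hm : Measurable m) (h₀ : Measurable q₀)
    (h₁ : Measurable q₁) (hq : ∀ t, AdmissibleQuadratic k (q₀ t) (q₁ t)) {V : Space d → ℝ}
    (hV : Measurable V) {κ : Space d → ENNReal} (hκm : Measurable κ) {C : NNReal}
    (hC : ∀ x, κ x ≠ ⊤ →
      ∫⁻ t in Set.Ioi (0 : ℝ), ‖m t * regGauss q₀ q₁ t ‖x‖‖ₑ ≤ C * κ x)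
    (hVκ : ∀ x, κ x ≠ ⊤ → V x = ∫ t in Set.Ioi (0 : ℝ), m t * regGauss q₀ q₁ t ‖x‖) :
    Represents k V κ (mixtureHat m) where
  measurable_kernel := hV
  measurable_bound := hκm
  bound := by
    refine ⟨C + 1, fun x => ?_⟩
    by_cases hx : κ x = ⊤
    · rw [hx, ENNReal.mul_top]
      · exact le_top
      · simp
    · rw [hVκ x hx]
      refine (enorm_integral_le_lintegral_enorm _).trans ((hC x hx).trans ?_)
      gcongr
      simp
  pairing := by
    intro X _ ν _ u g h hp h0 hκ
    have hu := hp.measurable_map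
    have hh : Measurable h := by
      have := Complex.measurable_re.comp hp.measurable_dual
      simpa [Function.comp_def] using this
    -- The mixture formula is only known where κ is finite. Elsewhere g vanishes almost everywhere,
    -- since the integral of κ|g| is finite.
    have hfin : ∀ᵐ x ∂ν, g x = 0 ∨ κ (u x) ≠ ⊤ := by
      have h1 : AEMeasurable (fun x => κ (u x) * ‖g x‖ₑ) ν :=
        (hκm.comp hu).aemeasurable.mul hp.integrable.1.enorm
      filter_upwards [ae_lt_top' h1 hκ.ne] with x hx
      by_contra! hc
      rw [hc.2, ENNReal.top_mul (by simpa using hc.1)] at hx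
      exact lt_irrefl _ hx
    have hD : Measurable fun p : X × ℝ => m p.2 * regGauss q₀ q₁ p.2 ‖u p.1‖ := by
      unfold regGauss; fun_prop
    have hF : Integrable (fun p : X × ℝ => ((m p.2 * regGauss q₀ q₁ p.2 ‖u p.1‖ : ℝ) : ℂ) * g p.1)
        (ν.prod (volume.restrict (Set.Ioi (0 : ℝ)))) := by
      have hmeas : AEStronglyMeasurable
          (fun p : X × ℝ => ((m p.2 * regGauss q₀ q₁ p.2 ‖u p.1‖ : ℝ) : ℂ) * g p.1)
          (ν.prod (volume.restrict (Set.Ioi (0 : ℝ)))) :=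
        (Complex.measurable_ofReal.comp hD).aestronglyMeasurable.mul hp.integrable.1.comp_fst
      refine ⟨hmeas, ?_⟩
      rw [HasFiniteIntegral, lintegral_prod _ hmeas.enorm]
      refine lt_of_le_of_lt (lintegral_mono_ae (g := fun x => C * (κ (u x) * ‖g x‖ₑ)) ?_) ?_
      · filter_upwards [hfin] with x hx
        rcases hx with hx | hx
        · simp [hx]
        · simp only [enorm_mul]
          rw [lintegral_mul_const' _ _ enorm_ne_top, ← mul_assoc]
          gcongr
          refine le_trans (le_of_eq ?_) (hC (u x) hx)
          refine lintegral_congr fun t => ?_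
          simp [enorm_eq_nnnorm]
      · rw [lintegral_const_mul' _ _ ENNReal.coe_ne_top]
        exact ENNReal.mul_lt_top ENNReal.coe_lt_top hκ
    have hinner : ∀ t ∈ Set.Ioi (0 : ℝ),
        ∫ x, ((m t * regGauss q₀ q₁ t ‖u x‖ : ℝ) : ℂ) * g x ∂ν =
          ((∫ ξ, m t * gaussHat t ξ * h ξ : ℝ) : ℂ) := by
      intro t ht
      obtain ⟨j1, j2⟩ := hp.quadratic _ _ (hq t)
      obtain ⟨j3, j4⟩ := hp.gaussian t ht
      have j5 : Integrable (fun x => (Real.exp (-t * ‖u x‖ ^ 2) : ℂ) * g x) ν := by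
        refine hp.integrable.bdd_mul (c := 1) ?_ (Filter.Eventually.of_forall fun x => ?_)
        · refine Measurable.aestronglyMeasurable ?_
          fun_prop
        · rw [Complex.norm_real, Real.norm_eq_abs, Real.abs_exp, Real.exp_le_one_iff]
          have : 0 < t := ht
          nlinarith [sq_nonneg ‖u x‖]
      have e : ∀ x, ((m t * regGauss q₀ q₁ t ‖u x‖ : ℝ) : ℂ) * g x = m t *
          ((Real.exp (-t * ‖u x‖ ^ 2) : ℂ) * g x -
            ((q₀ t + q₁ t * ‖u x‖ ^ 2 : ℝ) : ℂ) * g x) := by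
        intro x
        unfold regGauss
        push_cast
        ring
      simp_rw [e]
      rw [integral_const_mul, integral_sub j5 j1, j2, sub_zero, j4, ← integral_const_mul,
        ← integral_complex_ofReal]
      refine integral_congr_ae (Filter.Eventually.of_forall fun ξ => ?_)
      push_cast
      ring
    have hG : Integrable (fun p : ℝ × Space d => m p.1 * gaussHat p.1 p.2 * h p.2)
        ((volume.restrict (Set.Ioi (0 : ℝ))).prod volume) := by
      have hmeas : Measurable fun p : ℝ × Space d => m p.1 * gaussHat p.1 p.2 * h p.2 :=
        ((hm.comp measurable_fst).mul measurable_gaussHat_uncurry).mul (hh.comp measurable_snd)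
      rw [integrable_prod_iff hmeas.aestronglyMeasurable]
      constructor
      · refine (ae_restrict_mem measurableSet_Ioi).mono fun t ht => ?_
        have := (hp.gaussian t ht).1.re.const_mul (m t)
        refine this.congr (Filter.Eventually.of_forall fun ξ => ?_)
        simp [mul_assoc]
      -- Positivity of `gaussHat` and h makes the ξ-integral of the norm equal to the norm of the
      -- ξ-integral, hence to the norm of the x-integral of the corrected Gaussian, already known to
      -- be integrable in t.
      · refine (hF.integral_prod_right.norm).congr ?_
        refine (ae_restrict_mem measurableSet_Ioi).mono fun t ht => ?_
        simp only
        rw [hinner t ht, Complex.norm_real]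
        have e : ∀ ξ, m t * gaussHat t ξ * h ξ = m t * (gaussHat t ξ * h ξ) := fun ξ => by ring
        simp_rw [e]
        rw [integral_const_mul, norm_mul]
        simp_rw [norm_mul (m t)]
        rw [integral_const_mul]
        congr 1
        rw [Real.norm_of_nonneg]
        · refine integral_congr_ae (Filter.Eventually.of_forall fun ξ => ?_)
          exact (Real.norm_of_nonneg (mul_nonneg (gaussHat_nonneg (le_of_lt ht) ξ) (h0 ξ))).symm
        · exact integral_nonneg fun ξ => mul_nonneg (gaussHat_nonneg (le_of_lt ht) ξ) (h0 ξ)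
    have hw : ∀ ξ, ∫ t in Set.Ioi (0 : ℝ), m t * gaussHat t ξ * h ξ = mixtureHat m ξ * h ξ :=
      fun ξ => by rw [integral_mul_const, mixtureHat]
    constructor
    · have := hG.integral_prod_right
      simp_rw [hw] at this
      exact this
    · have e1 : ∫ x, (V (u x) : ℂ) * g x ∂ν =
          ∫ x, (∫ t in Set.Ioi (0 : ℝ), ((m t * regGauss q₀ q₁ t ‖u x‖ : ℝ) : ℂ) * g x) ∂ν := by
        refine integral_congr_ae ?_
        filter_upwards [hfin] with x hx
        rcases hx with hx | hx
        · simp [hx]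
        · rw [hVκ _ hx, integral_mul_const, integral_complex_ofReal]
      rw [e1, integral_integral_swap hF, setIntegral_congr_fun measurableSet_Ioi hinner,
        integral_complex_ofReal, integral_complex_ofReal, integral_integral_swap hG]
      simp_rw [hw]

/-! ### Cutoffs -/

lemma exists_cutoff {r : ℝ} (hr : 0 < r) (R : ℝ) :
    ∃ ψ : Space d → ℝ, ContDiff ℝ (⊤ : ℕ∞) ψ ∧ HasCompactSupport ψ ∧ (0 : Space d) ∉ tsupport ψ ∧
      (∀ x, 0 ≤ ψ x) ∧ ∀ x, r ≤ ‖x‖ → ‖x‖ ≤ R → ψ x = 1 := by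
  let f : ContDiffBump (0 : Space d) := ⟨|R| + 1, |R| + 2, by positivity, by linarith⟩
  let g : ContDiffBump (0 : Space d) := ⟨r / 2, r, by positivity, by linarith⟩
  refine ⟨fun x => f x * (1 - g x), f.contDiff.mul (contDiff_const.sub g.contDiff),
    f.hasCompactSupport.mul_right, ?_, ?_, ?_⟩
  · rw [notMem_tsupport_iff_eventuallyEq]
    filter_upwards [Metric.closedBall_mem_nhds (0 : Space d) g.rIn_pos] with x hx
    simp [g.one_of_mem_closedBall hx]
  · exact fun x => mul_nonneg f.nonneg (by linarith [g.le_one (x := x)])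
  · intro x h1 h2
    have e1 : f x = 1 := f.one_of_mem_closedBall (by
      simp only [Metric.mem_closedBall, dist_zero_right, f]
      linarith [le_abs_self R])
    have e2 : g x = 0 := g.zero_of_le_dist (by simpa [g] using h1)
    simp [e1, e2]

/-- A real smooth compactly supported function as a complex Schwartz function. -/
def realTest {ψ : Space d → ℝ} (h₁ : ContDiff ℝ (⊤ : ℕ∞) ψ) (h₂ : HasCompactSupport ψ) :
    𝓢(Space d, ℂ) :=
  HasCompactSupport.toSchwartzMap (f := fun x => (ψ x : ℂ)) (h₂.comp_left Complex.ofReal_zero)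
    (Complex.ofRealCLM.contDiff.comp h₁)

@[simp]
lemma realTest_apply {ψ : Space d → ℝ} (h₁ : ContDiff ℝ (⊤ : ℕ∞) ψ) (h₂ : HasCompactSupport ψ)
    (x : Space d) : realTest h₁ h₂ x = (ψ x : ℂ) := rfl

lemma zero_notMem_tsupport_realTest {ψ : Space d → ℝ} (h₁ : ContDiff ℝ (⊤ : ℕ∞) ψ)
    (h₂ : HasCompactSupport ψ) (h₀ : (0 : Space d) ∉ tsupport ψ) :
    (0 : Space d) ∉ tsupport (realTest h₁ h₂) := by
  rw [notMem_tsupport_iff_eventuallyEq] at h₀ ⊢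
  filter_upwards [h₀] with x hx
  simp [hx]

/-! ### The distribution defined by a kernel -/

lemma norm_schwartz_le (N : ℕ) (f : 𝓢(Space d, ℂ)) (x : Space d) :
    ‖f x‖ ≤ (1 + ‖x‖) ^ (-(N : ℝ)) *
      (2 ^ N * ((Finset.Iic (N, 0)).sup (fun m : ℕ × ℕ => SchwartzMap.seminorm ℂ m.1 m.2) f)) := by
  rw [Real.rpow_neg (by positivity), ← div_eq_inv_mul, le_div_iff₀' (by positivity),
    Real.rpow_natCast]
  simpa using SchwartzMap.one_add_le_sup_seminorm_apply (𝕜 := ℂ) (m := (N, 0)) (k := N) (n := 0)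
    le_rfl le_rfl f x

/-- Integration against a polynomially bounded kernel, as a tempered distribution. -/
def kernelDistribution (V : Space d → ℝ) (hV : Measurable V) (N : ℕ)
    (hN : Integrable fun x => ‖V x‖ * (1 + ‖x‖) ^ (-(N : ℝ))) : 𝓢'(Space d, ℂ) :=
  have hi : ∀ f : 𝓢(Space d, ℂ), Integrable fun x => f x * (V x : ℂ) := fun f => by
    refine (hN.mul_const (2 ^ N * ((Finset.Iic (N, 0)).sup
      (fun m : ℕ × ℕ => SchwartzMap.seminorm ℂ m.1 m.2) f))).mono' ?_
      (Filter.Eventually.of_forall fun x => ?_)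
    · exact f.continuous.aestronglyMeasurable.mul
        (Complex.measurable_ofReal.comp hV).aestronglyMeasurable
    · rw [norm_mul, Complex.norm_real, mul_comm, mul_assoc]
      exact mul_le_mul_of_nonneg_left (norm_schwartz_le N f x) (norm_nonneg _)
  ContinuousLinearMap.toPointwiseConvergenceCLM _ _ _ _ <|
    SchwartzMap.mkCLMtoNormedSpace (fun f : 𝓢(Space d, ℂ) => ∫ x, f x * (V x : ℂ))
    (fun f g => by
      simp only [_root_.add_apply, add_mul]
      exact integral_add (hi f) (hi g))
    (fun c f => by
      simp only [_root_.smul_apply, smul_eq_mul, mul_assoc, RingHom.id_apply]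
      exact integral_const_mul _ _)
    (by
      refine ⟨Finset.Iic (N, 0), 2 ^ N * ∫ x, ‖V x‖ * (1 + ‖x‖) ^ (-(N : ℝ)),
        mul_nonneg (by positivity) (integral_nonneg fun x => by positivity), fun f => ?_⟩
      refine (norm_integral_le_of_norm_le (hN.mul_const (2 ^ N * ((Finset.Iic (N, 0)).sup
        (fun m : ℕ × ℕ => SchwartzMap.seminorm ℂ m.1 m.2) f)))
        (Filter.Eventually.of_forall fun x => ?_)).trans (le_of_eq ?_)
      · rw [norm_mul, Complex.norm_real, mul_comm, mul_assoc]
        exact mul_le_mul_of_nonneg_left (norm_schwartz_le N f x) (norm_nonneg _)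
      · rw [integral_mul_const]
        unfold schwartzSeminormFamily
        ring)

lemma kernelDistribution_apply (V : Space d → ℝ) (hV : Measurable V) (N : ℕ)
    (hN : Integrable fun x => ‖V x‖ * (1 + ‖x‖) ^ (-(N : ℝ))) (f : 𝓢(Space d, ℂ)) :
    kernelDistribution V hV N hN f = ∫ x, f x * (V x : ℂ) := rfl

lemma lintegral_mul_schwartz_lt_top {κ : Space d → ENNReal} {N : ℕ}
    (hN : ∫⁻ x, κ x * ENNReal.ofReal ((1 + ‖x‖) ^ (-(N : ℝ))) < ⊤) (f : 𝓢(Space d, ℂ)) :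
    ∫⁻ x, κ x * ‖f x‖ₑ < ⊤ := by
  set C : ℝ := 2 ^ N * ((Finset.Iic (N, 0)).sup
        (fun m : ℕ × ℕ => SchwartzMap.seminorm ℂ m.1 m.2) f) with hC
  refine lt_of_le_of_lt (lintegral_mono (g := fun x =>
    κ x * ENNReal.ofReal ((1 + ‖x‖) ^ (-(N : ℝ))) * ENNReal.ofReal C) fun x => ?_) ?_
  · simp only
    rw [mul_assoc, ← ENNReal.ofReal_mul (by positivity), ← ofReal_norm]
    gcongr
    exact norm_schwartz_le N f x
  · rw [lintegral_mul_const' _ _ ENNReal.ofReal_ne_top]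
    exact ENNReal.mul_lt_top hN ENNReal.ofReal_lt_top

namespace Represents

variable {k : ℕ} {V : Space d → ℝ} {κ : Space d → ENNReal} {w : Space d → ℝ}

lemma integrable_weight (H : Represents k V κ w) {N : ℕ}
    (hN : ∫⁻ x, κ x * ENNReal.ofReal ((1 + ‖x‖) ^ (-(N : ℝ))) < ⊤) :
    Integrable fun x => ‖V x‖ * (1 + ‖x‖) ^ (-(N : ℝ)) := by
  have := H.measurable_kernel
  obtain ⟨C, hC⟩ := H.bound
  refine ⟨Measurable.aestronglyMeasurable (by fun_prop), ?_⟩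
  refine lt_of_le_of_lt (lintegral_mono (g := fun x =>
    C * (κ x * ENNReal.ofReal ((1 + ‖x‖) ^ (-(N : ℝ))))) fun x => ?_) ?_
  · simp only
    rw [enorm_mul, enorm_norm, ← mul_assoc,
      Real.enorm_of_nonneg (r := (1 + ‖x‖) ^ (-(N : ℝ))) (by positivity)]
    gcongr
    exact hC x
  · rw [lintegral_const_mul' _ _ ENNReal.coe_ne_top]
    exact ENNReal.mul_lt_top ENNReal.coe_lt_top hN

lemma pairing_test (H : Represents k V κ w) {N : ℕ}
    (hN : ∫⁻ x, κ x * ENNReal.ofReal ((1 + ‖x‖) ^ (-(N : ℝ))) < ⊤)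
    {ψ : Space d → ℝ} (h₁ : ContDiff ℝ (⊤ : ℕ∞) ψ)
    (h₂ : HasCompactSupport ψ) (h₃ : (0 : Space d) ∉ tsupport ψ) (h₀ : ∀ x, 0 ≤ ψ x) :
    Integrable (fun ξ => w ξ * ψ ξ) ∧
      ∫ x, (𝓕 (realTest h₁ h₂) : 𝓢(Space d, ℂ)) x * (V x : ℂ) =
        ∫ ξ, realTest h₁ h₂ ξ * (w ξ : ℂ) := by
  obtain ⟨i, e⟩ := H.pairing volume id _ ψ
    (gaussPair_testFunction k (realTest h₁ h₂) (zero_notMem_tsupport_realTest h₁ h₂ h₃)) h₀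
    (lintegral_mul_schwartz_lt_top hN _)
  refine ⟨i, ?_⟩
  simp only [id] at e
  simp_rw [mul_comm _ (V _ : ℂ), e, realTest_apply]
  refine integral_congr_ae (Filter.Eventually.of_forall fun ξ => ?_)
  push_cast
  ring

/-- The pairing includes integrability of w times the test function; a nonnegative cutoff equal to 1
on the annulus extracts that of w. -/
lemma integrableOn_annulus (H : Represents k V κ w) {N : ℕ}
    (hN : ∫⁻ x, κ x * ENNReal.ofReal ((1 + ‖x‖) ^ (-(N : ℝ))) < ⊤) {r : ℝ} (hr : 0 < r) (R : ℝ) :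
    IntegrableOn w {x | r ≤ ‖x‖ ∧ ‖x‖ ≤ R} := by
  obtain ⟨ψ, h₁, h₂, h₃, h₀, h₄⟩ := exists_cutoff (d := d) hr R
  refine (H.pairing_test hN h₁ h₂ h₃ h₀).1.integrableOn.congr_fun (fun x hx => ?_) ?_
  · simp [h₄ x hx.1 hx.2]
  · exact (measurableSet_le measurable_const measurable_norm).inter
      (measurableSet_le measurable_norm measurable_const)

lemma locallyIntegrableOn (H : Represents k V κ w) {N : ℕ}
    (hN : ∫⁻ x, κ x * ENNReal.ofReal ((1 + ‖x‖) ^ (-(N : ℝ))) < ⊤) :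
    LocallyIntegrableOn w {0}ᶜ := by
  intro x hx
  have hx0 : 0 < ‖x‖ := norm_pos_iff.2 (by simpa using hx)
  refine ⟨{y | ‖x‖ / 2 ≤ ‖y‖ ∧ ‖y‖ ≤ 2 * ‖x‖}, mem_nhdsWithin_of_mem_nhds ?_,
    H.integrableOn_annulus hN (by positivity) _⟩
  have := continuous_norm.continuousAt (x := x)
  filter_upwards [this.eventually (lt_mem_nhds (show ‖x‖ / 2 < ‖x‖ by linarith)),
    this.eventually (gt_mem_nhds (show ‖x‖ < 2 * ‖x‖ by linarith))] with y h1 h2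
  exact ⟨h1.le, h2.le⟩

/-- Pairings are available only for nonnegative test functions. A multiple Mχ of a cutoff dominates
|φ|, so Re φ and Im φ are each a difference of the nonnegative functions Re φ + Mχ, respectively Im
φ + Mχ, and Mχ. -/
lemma fourier_test (H : Represents k V κ w) {N : ℕ}
    (hN : ∫⁻ x, κ x * ENNReal.ofReal ((1 + ‖x‖) ^ (-(N : ℝ))) < ⊤) (φ : 𝓢(Space d, ℂ))
    (hφ : HasCompactSupport φ) (h0 : (0 : Space d) ∉ tsupport φ) :
    ∫ x, (𝓕 φ : 𝓢(Space d, ℂ)) x * (V x : ℂ) = ∫ ξ, φ ξ * (w ξ : ℂ) := by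
  obtain ⟨M, hM⟩ := hφ.exists_bound_of_continuous φ.continuous
  obtain ⟨R, hR⟩ := hφ.isCompact.isBounded.exists_norm_le
  obtain ⟨r, hr, hr'⟩ : ∃ r > 0, ∀ x ∈ tsupport φ, r ≤ ‖x‖ := by
    have := (isClosed_tsupport φ).isOpen_compl.mem_nhds h0
    obtain ⟨r, hr, hs⟩ := Metric.mem_nhds_iff.1 this
    refine ⟨r, hr, fun x hx => ?_⟩
    by_contra! hc
    exact hs (by simpa using hc) hx
  obtain ⟨χ, c₁, c₂, c₃, c₀, c₄⟩ := exists_cutoff (d := d) hr R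
  have hM0 : 0 ≤ M := (norm_nonneg _).trans (hM 0)
  have hle : ∀ x, ‖φ x‖ ≤ M * χ x := by
    intro x
    by_cases hx : x ∈ tsupport φ
    · rw [c₄ x (hr' x hx) (hR x hx), mul_one]; exact hM x
    · rw [image_eq_zero_of_notMem_tsupport hx, norm_zero]
      exact mul_nonneg hM0 (c₀ x)
  have s₁ : ContDiff ℝ (⊤ : ℕ∞) fun x => M * χ x := contDiff_const.mul c₁
  have k₁ : HasCompactSupport fun x => M * χ x := c₂.mul_left
  have z₁ : (0 : Space d) ∉ tsupport fun x => M * χ x := by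
    rw [notMem_tsupport_iff_eventuallyEq] at c₃ ⊢
    filter_upwards [c₃] with x hx
    simp [hx]
  have part : ∀ L : ℂ →L[ℝ] ℝ, (∀ z, |L z| ≤ ‖z‖) →
      ∃ (h₁ : ContDiff ℝ (⊤ : ℕ∞) fun x => L (φ x) + M * χ x)
        (h₂ : HasCompactSupport fun x => L (φ x) + M * χ x),
        ((0 : Space d) ∉ tsupport fun x => L (φ x) + M * χ x) ∧
        ∀ x, 0 ≤ L (φ x) + M * χ x := by
    intro L hL
    have hs : HasCompactSupport fun x => L (φ x) := hφ.comp_left (g := L) (map_zero L)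
    refine ⟨(L.contDiff.comp φ.smooth').add s₁, hs.add k₁, ?_, fun x => ?_⟩
    · rw [notMem_tsupport_iff_eventuallyEq] at z₁ h0 ⊢
      filter_upwards [z₁, h0] with x hx hx'
      simp only [Pi.zero_apply] at hx hx' ⊢
      simp [hx, hx']
    · linarith [neg_abs_le (L (φ x)), hL (φ x), hle x]
  obtain ⟨a₁, a₂, a₃, a₄⟩ := part Complex.reCLM Complex.abs_re_le_norm
  obtain ⟨b₁, b₂, b₃, b₄⟩ := part Complex.imCLM Complex.abs_im_le_norm
  obtain ⟨i₁, e₁⟩ := H.pairing_test hN s₁ k₁ z₁ fun x => mul_nonneg hM0 (c₀ x)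
  obtain ⟨i₂, e₂⟩ := H.pairing_test hN a₁ a₂ a₃ a₄
  obtain ⟨i₃, e₃⟩ := H.pairing_test hN b₁ b₂ b₃ b₄
  have hφe : φ = (realTest a₁ a₂ - realTest s₁ k₁) +
      Complex.I • (realTest b₁ b₂ - realTest s₁ k₁) := by
    ext x
    simp only [_root_.add_apply, _root_.sub_apply, _root_.smul_apply, realTest_apply,
      Complex.reCLM_apply, Complex.imCLM_apply, smul_eq_mul]
    push_cast
    rw [add_sub_cancel_right, add_sub_cancel_right, mul_comm]
    exact (Complex.re_add_im _).symm
  -- Viewing the left side as a continuous functional makes it linear in φ without separate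
  -- integrability checks for each transform.
  set T := kernelDistribution V H.measurable_kernel N (H.integrable_weight hN)
  have hT : ∀ f : 𝓢(Space d, ℂ), T (𝓕 f) = ∫ x, (𝓕 f : 𝓢(Space d, ℂ)) x * (V x : ℂ) :=
    fun f => kernelDistribution_apply ..
  have hI : ∀ {ψ : Space d → ℝ} (h₁ : ContDiff ℝ (⊤ : ℕ∞) ψ) (h₂ : HasCompactSupport ψ),
      Integrable (fun ξ => w ξ * ψ ξ) → Integrable fun ξ => realTest h₁ h₂ ξ * (w ξ : ℂ) := by
    intro ψ h₁ h₂ hi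
    refine hi.ofReal.congr (Filter.Eventually.of_forall fun x => ?_)
    simp [mul_comm]
  have hsub : ∀ {f g : Space d → ℂ}, Integrable f → Integrable g →
      Integrable fun x => f x - g x := fun hf hg => hf.sub hg
  have hw : ∫ ξ, φ ξ * (w ξ : ℂ) =
      ((∫ ξ, realTest a₁ a₂ ξ * (w ξ : ℂ)) - ∫ ξ, realTest s₁ k₁ ξ * (w ξ : ℂ)) +
      Complex.I * ((∫ ξ, realTest b₁ b₂ ξ * (w ξ : ℂ)) - ∫ ξ, realTest s₁ k₁ ξ * (w ξ : ℂ)) := by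
    rw [← integral_sub (hI a₁ a₂ i₂) (hI s₁ k₁ i₁), ← integral_sub (hI b₁ b₂ i₃) (hI s₁ k₁ i₁),
      ← integral_const_mul, ← integral_add (hsub (hI a₁ a₂ i₂) (hI s₁ k₁ i₁))
        ((hsub (hI b₁ b₂ i₃) (hI s₁ k₁ i₁)).const_mul _)]
    refine integral_congr_ae (Filter.Eventually.of_forall fun ξ => ?_)
    have := DFunLike.congr_fun hφe ξ
    simp only [_root_.add_apply, _root_.sub_apply, _root_.smul_apply,
      smul_eq_mul] at this ⊢
    rw [this]
    ring
  have hl : T (𝓕 φ) = (T (𝓕 (realTest a₁ a₂)) - T (𝓕 (realTest s₁ k₁))) +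
      Complex.I * (T (𝓕 (realTest b₁ b₂)) - T (𝓕 (realTest s₁ k₁))) := by
    have hF : ∀ f : 𝓢(Space d, ℂ), T (𝓕 f) =
        (T.comp (SchwartzMap.fourierTransformCLM ℂ : 𝓢(Space d, ℂ) →L[ℂ] 𝓢(Space d, ℂ))) f :=
      fun f => rfl
    rw [hF, hF, hF, hF]
    conv_lhs => rw [hφe]
    rw [map_add, map_smul, map_sub, map_sub, smul_eq_mul]
  rw [← hT, hl, hT, hT, hT, e₁, e₂, e₃, hw]

end Represents

/-! ### From represented kernels to Fourier representability -/

lemma fourierSigned_eq (μ : SignedMeasure (Space d)) (ξ : Space d) :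
    fourierSigned μ ξ = fourierDensity μ.totalVariation (signDensity μ) ξ := by
  rw [fourierSigned, integral_signedMeasure_eq, fourierDensity]
  simp_rw [Complex.real_smul]

lemma MomentVanishes.density {μ : SignedMeasure (Space d)} {j : ℕ} (h : MomentVanishes μ j) :
    DensityMomentVanishes μ.totalVariation (signDensity μ) j := by
  intro i
  have := h i
  rw [integral_signedMeasure_eq] at this
  simpa using this

/-- Differences of points of K form a compact set, on which W is bounded below. The negative part
thus has finite integral, and an infinite positive part would make the energy infinite. -/
lemma lintegral_posPart_lt_top_of_energy {W : Space d → EReal} (hW : IsPotential W)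
    {ρ : Measure (Space d)} [IsFiniteMeasure ρ] {K : Set (Space d)} (hK : IsCompact K)
    (hρ : ρ Kᶜ = 0) (hE : energy W ρ < ⊤) :
    ∫⁻ x, ∫⁻ y, (W (x - y)).toENNReal ∂ρ ∂ρ < ⊤ := by
  have hae : ∀ᵐ x ∂ρ, x ∈ K := by rw [ae_iff]; exact hρ
  obtain ⟨c, hc⟩ := hW.bddBelow_on_compact _ ((hK.prod hK).image continuous_sub)
  have hneg : ∫⁻ x, ∫⁻ y, (-W (x - y)).toENNReal ∂ρ ∂ρ < ⊤ := by
    refine lt_of_le_of_lt (lintegral_mono_ae (g := fun _ => ENNReal.ofReal (-c) * ρ Set.univ) ?_) ?_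
    · filter_upwards [hae] with x hx
      refine (lintegral_mono_ae (g := fun _ => ENNReal.ofReal (-c)) ?_).trans
        (by rw [lintegral_const])
      filter_upwards [hae] with y hy
      have h1 := EReal.toENNReal_le_toENNReal
        (EReal.neg_le_neg_iff.2 (hc _ ⟨(x, y), ⟨hx, hy⟩, rfl⟩))
      refine h1.trans (le_of_eq ?_)
      rw [← EReal.coe_neg, EReal.toENNReal_of_ne_top (EReal.coe_ne_top _), EReal.toReal_coe]
    · rw [lintegral_const]
      exact ENNReal.mul_lt_top (ENNReal.mul_lt_top ENNReal.ofReal_lt_top (measure_lt_top _ _))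
        (measure_lt_top _ _)
  by_contra htop
  rw [not_lt, top_le_iff] at htop
  rw [energy, htop] at hE
  have h2 : ((∫⁻ x, ∫⁻ y, (-W (x - y)).toENNReal ∂ρ ∂ρ : ENNReal) : EReal) ≠ ⊤ := by
    simpa using hneg.ne
  rw [EReal.coe_ennreal_top, EReal.top_sub h2, EReal.coe_mul_top_of_pos (by norm_num)] at hE
  exact lt_irrefl _ hE

/-- The test-function pair gives the transform off the origin and the pair built from μ ⊗ μ gives
the energy identity, with the same w. The bound on κ is local because μ has compact support. -/
theorem fourierRepresentable_of_represents (hd : 0 < d) {k : ℕ} {W : Space d → EReal}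
    (hW : IsPotential W) {κ : Space d → ENNReal} {w : Space d → ℝ}
    (H : Represents k (fun x => (W x).toReal) κ w) {N : ℕ}
    (hN : ∫⁻ x, κ x * ENNReal.ofReal ((1 + ‖x‖) ^ (-(N : ℝ))) < ⊤)
    (hκ : ∀ R : ℝ, ∃ C : NNReal, ∀ x, ‖x‖ ≤ R → κ x ≤ C * (1 + (W x).toENNReal)) :
    FourierRepresentable k W := by
  have : Nonempty (Fin d) := ⟨⟨0, hd⟩⟩
  refine ⟨hW, w, ⟨H.locallyIntegrableOn hN, kernelDistribution _ H.measurable_kernel N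
    (H.integrable_weight hN), fun φ _ => kernelDistribution_apply .., fun φ h₁ h₂ => ?_⟩, ?_⟩
  · rw [TemperedDistribution.fourier_apply, kernelDistribution_apply]
    exact H.fourier_test hN φ h₁ h₂
  · rintro μ ⟨K, hK, hμK⟩ hE hm
    have hs := measurable_signDensity μ
    have hs1 : ∀ x, |signDensity μ x| ≤ 1 := fun x => (abs_signDensity μ x).le
    set ρ := μ.totalVariation with hρ
    set s := signDensity μ with hsdef
    have hpos := lintegral_posPart_lt_top_of_energy hW hK hμK hE
    have hae : ∀ᵐ x ∂ρ, x ∈ K := by rw [ae_iff]; exact hμK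
    obtain ⟨R, hR⟩ := ((hK.prod hK).image continuous_sub).isBounded.exists_norm_le
    obtain ⟨C, hC⟩ := hκ R
    have hWm : Measurable W := hW.lowerSemicontinuous.measurable
    -- As |s| = 1, this is the integral of κ(x - y) against |μ| ⊗ |μ|, controlled by the total mass
    -- and the positive part of the energy.
    have hκi : ∫⁻ z : Space d × Space d,
        κ (z.1 - z.2) * ‖((s z.1 * s z.2 : ℝ) : ℂ)‖ₑ ∂(ρ.prod ρ) < ⊤ := by
      have hκm := H.measurable_bound
      rw [lintegral_prod _ (Measurable.aemeasurable (by fun_prop))]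
      refine lt_of_le_of_lt (lintegral_mono_ae
        (g := fun x => C * (ρ Set.univ + ∫⁻ y, (W (x - y)).toENNReal ∂ρ)) ?_) ?_
      · filter_upwards [hae] with x hx
        refine (lintegral_mono_ae (g := fun y => C * (1 + (W (x - y)).toENNReal)) ?_).trans ?_
        · filter_upwards [hae] with y hy
          have h1 : ‖((s x * s y : ℝ) : ℂ)‖ₑ = 1 := by
            rw [← ofReal_norm, Complex.norm_real, norm_mul, Real.norm_eq_abs, Real.norm_eq_abs,
              abs_signDensity, abs_signDensity]
            simp
          simp only [h1, mul_one]
          exact hC _ (hR _ ⟨(x, y), ⟨hx, hy⟩, rfl⟩)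
        · rw [lintegral_const_mul' _ _ ENNReal.coe_ne_top, lintegral_add_left measurable_const,
            lintegral_const, one_mul]
      · rw [lintegral_const_mul' _ _ ENNReal.coe_ne_top, lintegral_add_left measurable_const,
          lintegral_const]
        exact ENNReal.mul_lt_top ENNReal.coe_lt_top (ENNReal.add_lt_top.2
          ⟨ENNReal.mul_lt_top (measure_lt_top _ _) (measure_lt_top _ _), hpos⟩)
    have hp := gaussPair_energy (ρ := ρ) hs hs1 hK hμK fun j hj => (hm j hj).density
    obtain ⟨i, e⟩ := H.pairing (ρ.prod ρ) _ _ _ hp (fun ξ => by positivity) hκi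
    have hnull : (volume : Measure (Space d)).restrict {0}ᶜ = volume := by
      refine Measure.restrict_eq_self_of_ae_mem ?_
      rw [ae_iff]
      simp
    simp_rw [fourierSigned_eq]
    rw [IntegrableOn, hnull]
    refine ⟨i, ?_⟩
    rw [signedEnergy]
    congr 1
    simp_rw [integral_signedMeasure_eq, ← hρ, ← hsdef, smul_eq_mul]
    have hi := H.integrable_kernel hp.measurable_map hp.integrable.1 hκi
    have hi' : Integrable (fun z : Space d × Space d =>
        s z.1 * (s z.2 * (W (z.1 - z.2)).toReal)) (ρ.prod ρ) := by
      refine hi.re.congr (Filter.Eventually.of_forall fun z => ?_)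
      simp only [← Complex.ofReal_mul, RCLike.re_eq_complex_re, Complex.ofReal_re]
      ring
    simp_rw [← integral_const_mul]
    rw [integral_integral hi']
    apply Complex.ofReal_injective
    rw [← integral_complex_ofReal, ← integral_complex_ofReal, ← e]
    refine integral_congr_ae (Filter.Eventually.of_forall fun z => ?_)
    push_cast
    ring

open Set Filter Asymptotics Topology

/-! ### One-dimensional profiles -/

/-- These are the Mellin integral of Φ at -b/2 and its derivative in the exponent, both absolutely
convergent inside the strip given by the decay of Φ at 0 and infinity. -/
lemma mellin_profile_integrable {b e₀ e₁ : ℝ} {Φ : ℝ → ℝ} (hΦ : Continuous Φ)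
    (h₀ : Φ =O[𝓝[>] 0] fun s => s ^ e₀) (h₁ : Φ =O[atTop] fun s => s ^ e₁)
    (hb₀ : b / 2 < e₀) (hb₁ : e₁ < b / 2) :
    IntegrableOn (fun s => s ^ (-b / 2 - 1) * Φ s) (Ioi 0) ∧
      IntegrableOn (fun s => s ^ (-b / 2 - 1) * Real.log s * Φ s) (Ioi 0) := by
  have hloc : LocallyIntegrableOn (fun s => (Φ s : ℂ)) (Ioi 0) volume :=
    (Complex.continuous_ofReal.comp hΦ).locallyIntegrable.locallyIntegrableOn _
  have k₀ : (fun s => (Φ s : ℂ)) =O[𝓝[>] 0] fun s => s ^ (-(-e₀)) := by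
    rw [neg_neg]
    exact (isBigO_norm_left.1 (by simpa using h₀.norm_left))
  have k₁ : (fun s => (Φ s : ℂ)) =O[atTop] fun s => s ^ (-(-e₁)) := by
    rw [neg_neg]
    exact (isBigO_norm_left.1 (by simpa using h₁.norm_left))
  have hs : ((-b / 2 : ℝ) : ℂ).re = -b / 2 := Complex.ofReal_re _
  have c₁ : ((-b / 2 : ℝ) : ℂ).re < -e₁ := by rw [hs]; linarith
  have c₀ : -e₀ < ((-b / 2 : ℝ) : ℂ).re := by rw [hs]; linarith
  have H₁ := mellinConvergent_of_isBigO_rpow hloc k₁ c₁ k₀ c₀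
  have H₂ := (mellin_hasDerivAt_of_isBigO_rpow hloc k₁ c₁ k₀ c₀).1
  have hp : ∀ s ∈ Ioi (0 : ℝ), (s : ℂ) ^ (((-b / 2 : ℝ) : ℂ) - 1) =
      ((s ^ (-b / 2 - 1) : ℝ) : ℂ) := by
    intro s hs
    rw [Complex.ofReal_cpow (le_of_lt hs)]
    push_cast
    rfl
  constructor
  · refine (IntegrableOn.congr_fun H₁.re (fun s hs => ?_) measurableSet_Ioi)
    simp only [hp s hs, smul_eq_mul, ← Complex.ofReal_mul, RCLike.re_eq_complex_re,
      Complex.ofReal_re]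
  · refine (IntegrableOn.congr_fun H₂.re (fun s hs => ?_) measurableSet_Ioi)
    simp only [hp s hs, smul_eq_mul, Complex.real_smul, ← Complex.ofReal_mul,
      RCLike.re_eq_complex_re, Complex.ofReal_re]
    ring

lemma integral_Ioi_pos {f : ℝ → ℝ} (hf : IntegrableOn f (Ioi 0)) (h : ∀ s > 0, 0 < f s) :
    0 < ∫ s in Ioi (0 : ℝ), f s := by
  rw [setIntegral_pos_iff_support_of_nonneg_ae _ hf]
  · have : Function.support f ∩ Ioi 0 = Ioi 0 := by
      ext s
      simp only [mem_inter_iff, Function.mem_support, and_iff_right_iff_imp]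
      exact fun hs => (h s hs).ne'
    rw [this]
    simp
  · exact (ae_restrict_mem measurableSet_Ioi).mono fun s hs => (h s hs).le

lemma integral_profile_ne_zero {b : ℝ} {Φ : ℝ → ℝ}
    (hf : IntegrableOn (fun s => s ^ (-b / 2 - 1) * Φ s) (Ioi 0))
    (h : (∀ s > 0, 0 < Φ s) ∨ ∀ s > 0, Φ s < 0) :
    ∫ s in Ioi (0 : ℝ), s ^ (-b / 2 - 1) * Φ s ≠ 0 := by
  rcases h with h | h
  · exact (integral_Ioi_pos hf fun s hs => mul_pos (Real.rpow_pos_of_pos hs _) (h s hs)).ne'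
  · have := integral_Ioi_pos hf.neg fun s hs => by
      simpa using mul_neg_of_pos_of_neg (Real.rpow_pos_of_pos hs _) (h s hs)
    simp only [Pi.neg_apply, integral_neg] at this
    linarith

section Scaling

variable {b r : ℝ} {Φ : ℝ → ℝ}

/-- Prepares the substitution s = r²t: of the factor r^(b+2), the r² is absorbed by the Jacobian and
r^b is the homogeneity of the kernel. -/
lemma rpow_mul_profile (hr : 0 < r) {t : ℝ} (ht : 0 < t) :
    t ^ (-b / 2 - 1) * Φ (t * r ^ 2) =
      r ^ (b + 2) * ((r ^ 2 * t) ^ (-b / 2 - 1) * Φ (r ^ 2 * t)) := by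
  have h1 : (r ^ 2 * t) ^ (-b / 2 - 1) = r ^ (-(b + 2)) * t ^ (-b / 2 - 1) := by
    rw [Real.mul_rpow (by positivity) ht.le, ← Real.rpow_natCast r 2, ← Real.rpow_mul hr.le]
    congr 2
    push_cast
    ring
  rw [h1, Real.rpow_neg hr.le, mul_comm (r ^ 2) t]
  have : r ^ (b + 2) ≠ 0 := (Real.rpow_pos_of_pos hr _).ne'
  field_simp

lemma rpow_add_two (hr : 0 < r) (b : ℝ) : r ^ (b + 2) = r ^ b * r ^ 2 := by
  rw [Real.rpow_add hr, Real.rpow_two]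

lemma integral_scaled (hr : 0 < r) (f : ℝ → ℝ) :
    ∫ t in Ioi (0 : ℝ), r ^ (b + 2) * f (r ^ 2 * t) = r ^ b * ∫ s in Ioi (0 : ℝ), f s := by
  rw [integral_const_mul, integral_comp_mul_left_Ioi _ _ (by positivity), mul_zero, smul_eq_mul,
    rpow_add_two hr]
  field_simp

lemma integrableOn_scaled (hr : 0 < r) {f : ℝ → ℝ} (hf : IntegrableOn f (Ioi 0)) :
    IntegrableOn (fun t => r ^ (b + 2) * f (r ^ 2 * t)) (Ioi 0) := by
  refine Integrable.const_mul ?_ _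
  exact (integrableOn_Ioi_comp_mul_left_iff f 0 (by positivity : 0 < r ^ 2)).2
    (by simpa using hf)

lemma integral_profile (hr : 0 < r) :
    ∫ t in Ioi (0 : ℝ), t ^ (-b / 2 - 1) * Φ (t * r ^ 2) =
      r ^ b * ∫ s in Ioi (0 : ℝ), s ^ (-b / 2 - 1) * Φ s := by
  rw [setIntegral_congr_fun measurableSet_Ioi fun t ht => rpow_mul_profile hr ht]
  exact integral_scaled hr fun s => s ^ (-b / 2 - 1) * Φ s

lemma integrableOn_profile (hr : 0 < r)
    (hf : IntegrableOn (fun s => s ^ (-b / 2 - 1) * Φ s) (Ioi 0)) :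
    IntegrableOn (fun t => t ^ (-b / 2 - 1) * Φ (t * r ^ 2)) (Ioi 0) := by
  refine (integrableOn_scaled (b := b) hr hf).congr_fun (fun t ht => ?_) measurableSet_Ioi
  exact (rpow_mul_profile hr ht).symm

lemma lintegral_profile (hr : 0 < r)
    (hf : IntegrableOn (fun s => s ^ (-b / 2 - 1) * Φ s) (Ioi 0)) :
    ∫⁻ t in Ioi (0 : ℝ), ‖t ^ (-b / 2 - 1) * Φ (t * r ^ 2)‖ₑ =
      ENNReal.ofReal (r ^ b * ∫ s in Ioi (0 : ℝ), ‖s ^ (-b / 2 - 1) * Φ s‖) := by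
  rw [← ofReal_integral_norm_eq_lintegral_enorm (integrableOn_profile hr hf),
    ← integral_scaled (b := b) hr]
  congr 1
  refine setIntegral_congr_fun measurableSet_Ioi fun t ht => ?_
  rw [rpow_mul_profile hr ht, norm_mul, Real.norm_of_nonneg (Real.rpow_nonneg hr.le _)]

lemma rpow_mul_log_mul_profile (hr : 0 < r) {t : ℝ} (ht : 0 < t) :
    t ^ (-b / 2 - 1) * Real.log t * Φ (t * r ^ 2) =
      r ^ (b + 2) * ((r ^ 2 * t) ^ (-b / 2 - 1) * Real.log (r ^ 2 * t) * Φ (r ^ 2 * t)) -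
      2 * Real.log r * (t ^ (-b / 2 - 1) * Φ (t * r ^ 2)) := by
  have h := rpow_mul_profile (b := b) (Φ := Φ) hr ht
  have hl : Real.log (r ^ 2 * t) = 2 * Real.log r + Real.log t := by
    rw [Real.log_mul (by positivity) ht.ne', Real.log_pow]
    push_cast; rfl
  rw [hl]
  linear_combination (2 * Real.log r + Real.log t) * h

lemma integral_log_profile (hr : 0 < r)
    (hf : IntegrableOn (fun s => s ^ (-b / 2 - 1) * Φ s) (Ioi 0))
    (hg : IntegrableOn (fun s => s ^ (-b / 2 - 1) * Real.log s * Φ s) (Ioi 0)) :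
    ∫ t in Ioi (0 : ℝ), t ^ (-b / 2 - 1) * Real.log t * Φ (t * r ^ 2) =
      r ^ b * ((∫ s in Ioi (0 : ℝ), s ^ (-b / 2 - 1) * Real.log s * Φ s) -
        2 * Real.log r * ∫ s in Ioi (0 : ℝ), s ^ (-b / 2 - 1) * Φ s) := by
  rw [setIntegral_congr_fun measurableSet_Ioi fun t ht => rpow_mul_log_mul_profile hr ht,
    integral_sub (integrableOn_scaled (b := b) hr hg)
      ((integrableOn_profile hr hf).const_mul _),
    integral_scaled (b := b) hr fun s => s ^ (-b / 2 - 1) * Real.log s * Φ s,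
    integral_const_mul, integral_profile hr]
  ring

lemma lintegral_log_profile_le (hr : 0 < r)
    (hf : IntegrableOn (fun s => s ^ (-b / 2 - 1) * Φ s) (Ioi 0))
    (hg : IntegrableOn (fun s => s ^ (-b / 2 - 1) * Real.log s * Φ s) (Ioi 0)) :
    ∫⁻ t in Ioi (0 : ℝ), ‖t ^ (-b / 2 - 1) * Real.log t * Φ (t * r ^ 2)‖ₑ ≤
      ENNReal.ofReal ((∫ s in Ioi (0 : ℝ), ‖s ^ (-b / 2 - 1) * Real.log s * Φ s‖) +
        2 * ∫ s in Ioi (0 : ℝ), ‖s ^ (-b / 2 - 1) * Φ s‖) *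
      ENNReal.ofReal (r ^ b * (1 + |Real.log r|)) := by
  have i₁ := integrableOn_scaled (b := b) hr hg
  have i₂ := (integrableOn_profile hr hf).const_mul (2 * Real.log r)
  have A : 0 ≤ ∫ s in Ioi (0 : ℝ), ‖s ^ (-b / 2 - 1) * Real.log s * Φ s‖ :=
    integral_nonneg fun _ => norm_nonneg _
  have B : 0 ≤ ∫ s in Ioi (0 : ℝ), ‖s ^ (-b / 2 - 1) * Φ s‖ :=
    integral_nonneg fun _ => norm_nonneg _
  have hrb := Real.rpow_pos_of_pos hr b
  rw [setLIntegral_congr_fun measurableSet_Ioi fun t ht => by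
    rw [rpow_mul_log_mul_profile hr ht]]
  refine (lintegral_mono fun t => enorm_sub_le).trans ?_
  rw [lintegral_add_left' i₁.1.enorm, ← ofReal_integral_norm_eq_lintegral_enorm i₁]
  simp_rw [enorm_mul (2 * Real.log r)]
  rw [lintegral_const_mul' _ _ enorm_ne_top, lintegral_profile hr hf, ← ofReal_norm,
    ← ENNReal.ofReal_mul (norm_nonneg _), ← ENNReal.ofReal_add (integral_nonneg fun _ =>
    norm_nonneg _) (by positivity), ← ENNReal.ofReal_mul (by positivity)]
  refine ENNReal.ofReal_le_ofReal ?_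
  have e : ∫ t in Ioi (0 : ℝ), ‖r ^ (b + 2) *
      ((r ^ 2 * t) ^ (-b / 2 - 1) * Real.log (r ^ 2 * t) * Φ (r ^ 2 * t))‖ =
      r ^ b * ∫ s in Ioi (0 : ℝ), ‖s ^ (-b / 2 - 1) * Real.log s * Φ s‖ := by
    rw [← integral_scaled (b := b) hr]
    refine setIntegral_congr_fun measurableSet_Ioi fun t ht => ?_
    rw [norm_mul (r ^ (b + 2)), Real.norm_of_nonneg (Real.rpow_nonneg hr.le _)]
  rw [e, norm_mul, Real.norm_eq_abs (Real.log r), Real.norm_ofNat]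
  nlinarith [mul_nonneg (mul_nonneg hrb.le A) (abs_nonneg (Real.log r)),
    mul_nonneg hrb.le B, mul_nonneg (mul_nonneg hrb.le B) (abs_nonneg (Real.log r))]

end Scaling

/-! ### Frullani integrals -/

/-- From 1 - exp(-u) ≤ u. The factor t cancels the singular weight t⁻¹ and leaves integrable
exponentials. -/
lemma abs_exp_sub_exp_le {a c t : ℝ} (ht : 0 ≤ t) :
    |Real.exp (-(a * t)) - Real.exp (-(c * t))| ≤
      t * (|a - c| * (Real.exp (-a * t) + Real.exp (-c * t))) := by
  have key : ∀ a c : ℝ, a ≤ c → |Real.exp (-(a * t)) - Real.exp (-(c * t))| ≤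
      t * (|a - c| * (Real.exp (-a * t) + Real.exp (-c * t))) := by
    intro a c hac
    have h1 : Real.exp (-(c * t)) = Real.exp (-(a * t)) * Real.exp (-((c - a) * t)) := by
      rw [← Real.exp_add]; ring_nf
    have h2 := Real.add_one_le_exp (-((c - a) * t))
    have h3 : Real.exp (-(c * t)) ≤ Real.exp (-(a * t)) :=
      Real.exp_le_exp.2 (by nlinarith)
    rw [abs_of_nonneg (by linarith), abs_of_nonpos (by linarith)]
    simp only [neg_mul]
    have h4 := Real.exp_pos (-(a * t))
    have h5 := Real.exp_pos (-(c * t))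
    have h6 : Real.exp (-(a * t)) * (1 - (c - a) * t) ≤ Real.exp (-(c * t)) := by
      rw [h1]; exact mul_le_mul_of_nonneg_left (by linarith) h4.le
    nlinarith [mul_nonneg (mul_nonneg ht (sub_nonneg.2 hac)) h5.le]
  rcases le_total a c with h | h
  · exact key a c h
  · rw [abs_sub_comm, abs_sub_comm a c, add_comm (Real.exp (-a * t))]
    exact key c a h

lemma integrableOn_frullani {a c : ℝ} (ha : 0 < a) (hc : 0 < c) :
    IntegrableOn (fun t => t⁻¹ * (Real.exp (-(a * t)) - Real.exp (-(c * t)))) (Ioi 0) := by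
  refine (((exp_neg_integrableOn_Ioi 0 ha).add (exp_neg_integrableOn_Ioi 0 hc)).const_mul
    |a - c|).mono' ?_ ?_
  · exact Measurable.aestronglyMeasurable (by fun_prop)
  · refine (ae_restrict_mem measurableSet_Ioi).mono fun t ht => ?_
    have ht' : 0 < t := ht
    rw [norm_mul, norm_inv, Real.norm_of_nonneg ht'.le, inv_mul_le_iff₀ ht']
    exact abs_exp_sub_exp_le ht'.le

lemma integral_frullani {a c : ℝ} (ha : 0 < a) (hc : 0 < c) :
    ∫ t in Ioi (0 : ℝ), t⁻¹ * (Real.exp (-(a * t)) - Real.exp (-(c * t))) = Real.log (c / a) := by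
  have hcont : Continuous fun t : ℝ => Real.exp (-t) := by fun_prop
  have h := Frullani.integral_Ioi_eq (f := fun t : ℝ => Real.exp (-t)) (L := 1) (R := 0)
    (hcont.locallyIntegrable.locallyIntegrableOn _) ha hc
    ((hcont.tendsto' 0 1 (by simp)).mono_left nhdsWithin_le_nhds)
    (Real.tendsto_exp_neg_atTop_nhds_zero) (by simpa using integrableOn_frullani ha hc)
  simpa using h

/-- The integrand has constant sign, so no mass is lost to cancellation and the absolute integral is
the absolute value of the Frullani integral. -/
lemma lintegral_frullani {a c : ℝ} (ha : 0 < a) (hc : 0 < c) :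
    ∫⁻ t in Ioi (0 : ℝ), ‖t⁻¹ * (Real.exp (-(a * t)) - Real.exp (-(c * t)))‖ₑ =
      ENNReal.ofReal |Real.log (c / a)| := by
  have key : ∀ a c : ℝ, 0 < a → 0 < c → a ≤ c →
      ∫⁻ t in Ioi (0 : ℝ), ‖t⁻¹ * (Real.exp (-(a * t)) - Real.exp (-(c * t)))‖ₑ =
      ENNReal.ofReal |Real.log (c / a)| := by
    intro a c ha hc hac
    rw [← ofReal_integral_norm_eq_lintegral_enorm (integrableOn_frullani ha hc),
      abs_of_nonneg (Real.log_nonneg ((one_le_div ha).2 hac)), ← integral_frullani ha hc]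
    congr 1
    refine setIntegral_congr_fun measurableSet_Ioi fun t ht => ?_
    have ht' : 0 < t := ht
    refine Real.norm_of_nonneg (mul_nonneg (by positivity) (sub_nonneg.2 (Real.exp_le_exp.2 ?_)))
    nlinarith
  rcases le_total a c with h | h
  · exact key a c ha hc h
  · have := key c a hc ha h
    rw [← inv_div, Real.log_inv, abs_neg] at this
    rw [← this]
    refine lintegral_congr fun t => ?_
    rw [← enorm_neg]
    congr 1
    ring

/-! ### Dominating kernels and scale-invariant profiles -/

open Classical in
/-- The dominating kernel `|x|^b`, infinite at the origin if `b ≤ 0`. -/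
def powBound (d : ℕ) (b : ℝ) (x : Space d) : ENNReal :=
  if x = 0 ∧ b ≤ 0 then ⊤ else ENNReal.ofReal (‖x‖ ^ b)

open Classical in
/-- The dominating kernel `|x|^b (1 + |log |x||)`, infinite at the origin if `b ≤ 0`. -/
def logBound (d : ℕ) (b : ℝ) (x : Space d) : ENNReal :=
  if x = 0 ∧ b ≤ 0 then ⊤ else ENNReal.ofReal (‖x‖ ^ b * (1 + |Real.log ‖x‖|))

lemma measurableSet_zero_and (b : ℝ) : MeasurableSet {x : Space d | x = 0 ∧ b ≤ 0} := by
  by_cases hb : b ≤ 0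
  · simp [hb]
  · simp [hb]

lemma measurable_powBound (b : ℝ) : Measurable (powBound d b) :=
  Measurable.ite (measurableSet_zero_and b) measurable_const (by fun_prop)

lemma measurable_logBound (b : ℝ) : Measurable (logBound d b) := by
  refine Measurable.ite (measurableSet_zero_and b) measurable_const ?_
  have : Measurable fun x : Space d => |Real.log ‖x‖| := 
    (Real.measurable_log.comp measurable_norm).abs
  fun_prop

lemma powBound_of_ne {b : ℝ} {x : Space d} (hx : x ≠ 0) :
    powBound d b x = ENNReal.ofReal (‖x‖ ^ b) := by simp [powBound, hx]

lemma logBound_of_ne {b : ℝ} {x : Space d} (hx : x ≠ 0) :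
    logBound d b x = ENNReal.ofReal (‖x‖ ^ b * (1 + |Real.log ‖x‖|)) := by simp [logBound, hx]

lemma powBound_zero_of_nonpos {b : ℝ} (hb : b ≤ 0) : powBound d b 0 = ⊤ := by simp [powBound, hb]

lemma logBound_zero_of_nonpos {b : ℝ} (hb : b ≤ 0) : logBound d b 0 = ⊤ := by simp [logBound, hb]

lemma powBound_le_logBound (b : ℝ) (x : Space d) :
    powBound d b x ≤ (1 : NNReal) * logBound d b x := by
  rw [ENNReal.coe_one, one_mul, powBound, logBound]
  split_ifs
  · exact le_rfl
  · refine ENNReal.ofReal_le_ofReal (le_mul_of_one_le_right (by positivity) ?_)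
    linarith [abs_nonneg (Real.log ‖x‖)]

section Profile

variable {k : ℕ} {b : ℝ} {Φ q₀ q₁ : ℝ → ℝ}

lemma represents_rpow_profile (h₀ : Measurable q₀) (h₁ : Measurable q₁)
    (hq : ∀ t, AdmissibleQuadratic k (q₀ t) (q₁ t))
    (hreg : ∀ t r, regGauss q₀ q₁ t r = Φ (t * r ^ 2)) (hΦ : 0 < b → Φ 0 = 0)
    (hf : IntegrableOn (fun s => s ^ (-b / 2 - 1) * Φ s) (Ioi 0)) :
    ∃ w, Represents k
      (fun x : Space d => (∫ s in Ioi (0 : ℝ), s ^ (-b / 2 - 1) * Φ s) * ‖x‖ ^ b)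
      (powBound d b) w := by
  refine ⟨_, represents_mixture (m := fun t => t ^ (-b / 2 - 1)) (by fun_prop) h₀ h₁ hq
    (by fun_prop) (measurable_powBound b)
    (C := (∫ s in Ioi (0 : ℝ), ‖s ^ (-b / 2 - 1) * Φ s‖).toNNReal) (fun x hx => ?_)
    fun x hx => ?_⟩
  · simp_rw [hreg]
    rcases eq_or_ne x 0 with rfl | h0
    · have hb : 0 < b := by
        by_contra! hb
        exact hx (powBound_zero_of_nonpos hb)
      simp [hΦ hb]
    · rw [lintegral_profile (norm_pos_iff.2 h0) hf, powBound_of_ne h0, mul_comm,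
        ENNReal.ofReal_mul (integral_nonneg fun _ => norm_nonneg _)]
      rfl
  · simp_rw [hreg]
    rcases eq_or_ne x 0 with rfl | h0
    · have hb : 0 < b := by
        by_contra! hb
        exact hx (powBound_zero_of_nonpos hb)
      simp [hΦ hb, Real.zero_rpow hb.ne']
    · rw [integral_profile (norm_pos_iff.2 h0), mul_comm]

lemma represents_log_profile (h₀ : Measurable q₀) (h₁ : Measurable q₁)
    (hq : ∀ t, AdmissibleQuadratic k (q₀ t) (q₁ t))
    (hreg : ∀ t r, regGauss q₀ q₁ t r = Φ (t * r ^ 2)) (hΦ : 0 < b → Φ 0 = 0)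
    (hf : IntegrableOn (fun s => s ^ (-b / 2 - 1) * Φ s) (Ioi 0))
    (hg : IntegrableOn (fun s => s ^ (-b / 2 - 1) * Real.log s * Φ s) (Ioi 0)) :
    ∃ w, Represents k
      (fun x : Space d => ‖x‖ ^ b * ((∫ s in Ioi (0 : ℝ), s ^ (-b / 2 - 1) * Real.log s * Φ s) -
        2 * Real.log ‖x‖ * ∫ s in Ioi (0 : ℝ), s ^ (-b / 2 - 1) * Φ s))
      (logBound d b) w := by
  refine ⟨_, represents_mixture (m := fun t => t ^ (-b / 2 - 1) * Real.log t) (by fun_prop) h₀ h₁ hq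
    (by fun_prop) (measurable_logBound b)
    (C := ((∫ s in Ioi (0 : ℝ), ‖s ^ (-b / 2 - 1) * Real.log s * Φ s‖) +
        2 * ∫ s in Ioi (0 : ℝ), ‖s ^ (-b / 2 - 1) * Φ s‖).toNNReal) (fun x hx => ?_)
    fun x hx => ?_⟩
  · simp_rw [hreg]
    rcases eq_or_ne x 0 with rfl | h0
    · have hb : 0 < b := by
        by_contra! hb
        exact hx (logBound_zero_of_nonpos hb)
      simp [hΦ hb]
    · rw [logBound_of_ne h0]
      exact lintegral_log_profile_le (norm_pos_iff.2 h0) hf hg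
  · simp_rw [hreg]
    rcases eq_or_ne x 0 with rfl | h0
    · have hb : 0 < b := by
        by_contra! hb
        exact hx (logBound_zero_of_nonpos hb)
      simp [hΦ hb, Real.zero_rpow hb.ne']
    · rw [integral_log_profile (norm_pos_iff.2 h0) hf hg]

/-- The weight t^(-b/2-1) gives I|x|^b, and the extra log t gives J|x|^b - 2I|x|^b log|x|. The
constant sign of Φ ensures I ≠ 0, so both kernels can be solved for. -/
theorem represents_of_profile (h₀ : Measurable q₀) (h₁ : Measurable q₁)
    (hq : ∀ t, AdmissibleQuadratic k (q₀ t) (q₁ t))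
    (hreg : ∀ t r, regGauss q₀ q₁ t r = Φ (t * r ^ 2)) (hΦ : 0 < b → Φ 0 = 0)
    (hf : IntegrableOn (fun s => s ^ (-b / 2 - 1) * Φ s) (Ioi 0))
    (hg : IntegrableOn (fun s => s ^ (-b / 2 - 1) * Real.log s * Φ s) (Ioi 0))
    (hsign : (∀ s > 0, 0 < Φ s) ∨ ∀ s > 0, Φ s < 0) :
    (∃ w, Represents k (fun x : Space d => ‖x‖ ^ b) (powBound d b) w) ∧
    ∃ w, Represents k (fun x : Space d => ‖x‖ ^ b * Real.log ‖x‖) (logBound d b) w := by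
  obtain ⟨w₁, H₁⟩ := represents_rpow_profile (d := d) h₀ h₁ hq hreg hΦ hf
  obtain ⟨w₂, H₂⟩ := represents_log_profile (d := d) h₀ h₁ hq hreg hΦ hf hg
  have hne := integral_profile_ne_zero hf hsign
  set I := ∫ s in Ioi (0 : ℝ), s ^ (-b / 2 - 1) * Φ s
  set J := ∫ s in Ioi (0 : ℝ), s ^ (-b / 2 - 1) * Real.log s * Φ s
  have H₃ : Represents k (fun x : Space d => ‖x‖ ^ b) (powBound d b) _ :=
    (H₁.const_mul I⁻¹).congr_kernel fun x => inv_mul_cancel_left₀ hne _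
  refine ⟨⟨_, H₃⟩, _, (((H₃.mono_bound (measurable_logBound b) 1
    (powBound_le_logBound b)).const_mul (J / (2 * I))).add
    (H₂.const_mul (-1 / (2 * I)))).congr_kernel fun x => ?_⟩
  field_simp
  ring

end Profile

/-! ### The power-law kernels -/

/-- The level at which the power law of exponent `b` is represented. -/
def powerLevel (b : ℝ) : ℕ := if b < 0 then 0 else if b < 2 then 1 else 2

lemma isBigO_rpow_nhdsGT {f : ℝ → ℝ} (C : ℝ) (n : ℕ) (h : ∀ s > 0, s ≤ 1 → |f s| ≤ C * s ^ n) :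
    f =O[𝓝[>] 0] fun s => s ^ (n : ℝ) := by
  refine IsBigO.of_bound C ?_
  filter_upwards [Ioc_mem_nhdsGT (zero_lt_one' ℝ)] with s hs
  rw [Real.rpow_natCast, Real.norm_of_nonneg (pow_nonneg hs.1.le n)]
  exact h s hs.1 hs.2

lemma isBigO_rpow_atTop {f : ℝ → ℝ} (C : ℝ) (n : ℕ) (h : ∀ s, 1 ≤ s → |f s| ≤ C * s ^ n) :
    f =O[atTop] fun s => s ^ (n : ℝ) := by
  refine IsBigO.of_bound C ?_
  filter_upwards [eventually_ge_atTop 1] with s hs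
  rw [Real.rpow_natCast, Real.norm_of_nonneg (pow_nonneg (zero_le_one.trans hs) n)]
  exact h s hs

/-- For negative b the weight is integrable at t = 0, so no correction is needed and level 0
suffices. -/
theorem represents_power_neg {b : ℝ} (hb : b < 0) :
    (∃ w, Represents 0 (fun x : Space d => ‖x‖ ^ b) (powBound d b) w) ∧
    ∃ w, Represents 0 (fun x : Space d => ‖x‖ ^ b * Real.log ‖x‖) (logBound d b) w := by
  obtain ⟨hf, hg⟩ := mellin_profile_integrable (b := b) (e₀ := (0 : ℕ)) (e₁ := b / 2 - 1)
    (Φ := fun s => Real.exp (-s)) (by fun_prop)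
    (isBigO_rpow_nhdsGT 1 0 fun s hs _ => by
      rw [Real.abs_exp]; simpa using hs.le)
    (by simpa using (isLittleO_exp_neg_mul_rpow_atTop zero_lt_one (b / 2 - 1)).isBigO)
    (by push_cast; linarith) (by linarith)
  refine represents_of_profile (q₀ := fun _ => 0) (q₁ := fun _ => 0) (by fun_prop) (by fun_prop)
    (fun t => ⟨fun _ => rfl, fun _ => rfl⟩) (fun t r => ?_) (fun h => by linarith) hf hg
    (Or.inl fun s _ => Real.exp_pos _)
  simp [regGauss]

/-- Subtracting 1 makes the profile O(s) at 0 and bounded at infinity, which is the strip 0 < b/2 <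
1. -/
theorem represents_power_one {b : ℝ} (hb : 0 < b) (hb' : b < 2) :
    (∃ w, Represents 1 (fun x : Space d => ‖x‖ ^ b) (powBound d b) w) ∧
    ∃ w, Represents 1 (fun x : Space d => ‖x‖ ^ b * Real.log ‖x‖) (logBound d b) w := by
  have hexp : ∀ s : ℝ, 0 < s → Real.exp (-s) < 1 := fun s hs => by
    rw [Real.exp_lt_one_iff]; linarith
  obtain ⟨hf, hg⟩ := mellin_profile_integrable (b := b) (e₀ := (1 : ℕ)) (e₁ := (0 : ℕ))
    (Φ := fun s => Real.exp (-s) - 1) (by fun_prop)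
    (isBigO_rpow_nhdsGT 1 1 fun s hs _ => by
      rw [abs_of_neg (by linarith [hexp s hs])]
      linarith [Real.add_one_le_exp (-s)])
    (isBigO_rpow_atTop 1 0 fun s hs => by
      rw [abs_of_neg (by linarith [hexp s (by linarith)])]
      linarith [Real.exp_pos (-s), pow_zero s])
    (by push_cast; linarith) (by push_cast; linarith)
  refine represents_of_profile (q₀ := fun _ => 1) (q₁ := fun _ => 0) (by fun_prop) (by fun_prop)
    (fun t => ⟨fun h => by simp at h, fun _ => rfl⟩) (fun t r => ?_) (fun h => by simp) hf hg
    (Or.inr fun s hs => by linarith [hexp s hs])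
  simp [regGauss]

/-- Removing the first-order Taylor polynomial makes the profile O(s²) at 0 and O(s) at infinity,
which is the strip 1 < b/2 < 2. -/
theorem represents_power_two {b : ℝ} (hb : 2 < b) (hb' : b < 4) :
    (∃ w, Represents 2 (fun x : Space d => ‖x‖ ^ b) (powBound d b) w) ∧
    ∃ w, Represents 2 (fun x : Space d => ‖x‖ ^ b * Real.log ‖x‖) (logBound d b) w := by
  have hexp : ∀ s : ℝ, 0 < s → 0 < Real.exp (-s) - 1 + s := fun s hs => by
    linarith [Real.one_sub_lt_exp_neg hs.ne']
  obtain ⟨hf, hg⟩ := mellin_profile_integrable (b := b) (e₀ := (2 : ℕ)) (e₁ := (1 : ℕ))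
    (Φ := fun s => Real.exp (-s) - 1 + s) (by fun_prop)
    (isBigO_rpow_nhdsGT 1 2 fun s hs hs' => by
      have := Real.abs_exp_sub_one_sub_id_le (x := -s) (by rw [abs_neg, abs_of_pos hs]; exact hs')
      simpa using this)
    (isBigO_rpow_atTop 1 1 fun s hs => by
      rw [abs_of_pos (hexp s (by linarith))]
      have : Real.exp (-s) ≤ 1 := by rw [Real.exp_le_one_iff]; linarith
      linarith)
    (by push_cast; linarith) (by push_cast; linarith)
  refine represents_of_profile (q₀ := fun _ => 1) (q₁ := fun t => -t) (by fun_prop) (by fun_prop)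
    (fun t => ⟨fun h => by simp at h, fun h => by simp at h⟩) (fun t r => ?_) (fun h => by simp)
    hf hg (Or.inl hexp)
  simp only [regGauss]
  ring_nf

/-- With weight t⁻¹, subtracting 1 would diverge at infinity. Subtracting exp(-t) leaves a Frullani
integral with value -2 log|x|. -/
theorem represents_log :
    ∃ w, Represents 1 (fun x : Space d => Real.log ‖x‖) (logBound d 0) w := by
  have e : ∀ t r : ℝ, t⁻¹ * regGauss (fun t => Real.exp (-t)) (fun _ => 0) t r =
      t⁻¹ * (Real.exp (-(r ^ 2 * t)) - Real.exp (-(1 * t))) := by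
    intro t r
    simp only [regGauss]
    ring_nf
  have hl : ∀ x : Space d, Real.log (1 / ‖x‖ ^ 2) = -2 * Real.log ‖x‖ := by
    intro x
    rw [one_div, Real.log_inv, Real.log_pow]
    push_cast; ring
  have H : Represents 1 (fun x : Space d => -2 * Real.log ‖x‖) (logBound d 0) _ :=
    represents_mixture (m := fun t => t⁻¹) (q₀ := fun t => Real.exp (-t)) (q₁ := fun _ => 0)
    (by fun_prop) (by fun_prop) (by fun_prop) (fun t => ⟨fun h => by simp at h, fun _ => rfl⟩)
    (by fun_prop) (measurable_logBound 0) (C := 2) (fun x hx => by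
      have h0 : x ≠ 0 := by
        rintro rfl
        exact hx (logBound_zero_of_nonpos le_rfl)
      have hr := norm_pos_iff.2 h0
      simp_rw [e]
      rw [lintegral_frullani (by positivity) one_pos, hl, logBound_of_ne h0,
        show ((2 : NNReal) : ENNReal) = ENNReal.ofReal 2 by simp,
        ← ENNReal.ofReal_mul (by norm_num)]
      refine ENNReal.ofReal_le_ofReal ?_
      rw [Real.rpow_zero, abs_mul]
      norm_num) (fun x hx => by
      have h0 : x ≠ 0 := by
        rintro rfl
        exact hx (logBound_zero_of_nonpos le_rfl)
      have hr := norm_pos_iff.2 h0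
      simp_rw [e]
      rw [integral_frullani (by positivity) one_pos, hl])
  exact ⟨_, (H.const_mul (-1 / 2)).congr_kernel fun x => by ring⟩

lemma represents_sq : ∃ w, Represents 2 (fun x : Space d => ‖x‖ ^ (2 : ℝ)) (powBound d 2) w := by
  refine ⟨_, (represents_quadratic (k := 2) (α := 0) (β := 1) (κ := powBound d 2) (C := 1)
    ⟨fun _ => rfl, fun h => by simp at h⟩ (measurable_powBound 2) fun x => ?_).congr_kernel
    fun x => ?_⟩
  · rw [powBound, if_neg (by norm_num), ENNReal.coe_one, one_mul, zero_add, one_mul,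
      Real.enorm_of_nonneg (by positivity), Real.rpow_two]
  · rw [Real.rpow_two]; ring

/-- At b = 2 the correction 1 - t|x|² would leave a divergent t⁻¹ tail. Damping its second term by
exp(-t) restores convergence but breaks scaling: the integrand splits into a scale-invariant profile
Φ, contributing I|x|², and |x|² times a Frullani integrand, contributing 2|x|² log|x|. -/
theorem represents_sq_mul_log :
    ∃ w, Represents 2 (fun x : Space d => ‖x‖ ^ (2 : ℝ) * Real.log ‖x‖) (logBound d 2) w := by
  set Φ : ℝ → ℝ := fun s => Real.exp (-s) - 1 + s * Real.exp (-s) with hΦ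
  obtain ⟨hf, -⟩ := mellin_profile_integrable (b := 2) (e₀ := (2 : ℕ)) (e₁ := (0 : ℕ))
    (Φ := Φ) (by fun_prop)
    (isBigO_rpow_nhdsGT 2 2 fun s hs hs' => by
      have h1 := Real.abs_exp_sub_one_sub_id_le (x := -s)
        (by rw [abs_neg, abs_of_pos hs]; exact hs')
      have h2 : |Real.exp (-s) - 1| ≤ s := by
        rw [abs_of_nonpos (by linarith [Real.exp_le_one_iff.2 (neg_nonpos.2 hs.le)])]
        linarith [Real.add_one_le_exp (-s)]
      have h3 : Φ s = (Real.exp (-s) - 1 - -s) + s * (Real.exp (-s) - 1) := by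
        simp only [hΦ]; ring
      rw [h3]
      refine (abs_add_le _ _).trans ?_
      rw [abs_mul, abs_of_pos hs]
      nlinarith)
    (isBigO_rpow_atTop 1 0 fun s hs => by
      have h1 := Real.add_one_le_exp s
      have h2 : Real.exp (-s) * Real.exp s = 1 := by rw [← Real.exp_add]; simp
      have h3 := Real.exp_pos (-s)
      simp only [hΦ]
      rw [pow_zero, mul_one, abs_le]
      constructor <;> nlinarith)
    (by norm_num) (by norm_num)
  have hΦ0 : Φ 0 = 0 := by simp [hΦ]
  set m : ℝ → ℝ := fun t => t ^ (-(2 : ℝ) / 2 - 1) with hm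
  set I := ∫ s in Ioi (0 : ℝ), s ^ (-(2 : ℝ) / 2 - 1) * Φ s
  set I' := ∫ s in Ioi (0 : ℝ), ‖s ^ (-(2 : ℝ) / 2 - 1) * Φ s‖
  have hI' : 0 ≤ I' := integral_nonneg fun _ => norm_nonneg _
  have e : ∀ r t : ℝ, t ∈ Ioi (0 : ℝ) →
      m t * regGauss (fun _ => 1) (fun t => -(t * Real.exp (-t))) t r =
      t ^ (-(2 : ℝ) / 2 - 1) * Φ (t * r ^ 2) +
        r ^ 2 * (t⁻¹ * (Real.exp (-(1 * t)) - Real.exp (-(r ^ 2 * t)))) := by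
    intro r t ht
    have ht' : t ≠ 0 := ne_of_gt ht
    have h2 : t ^ (-(2 : ℝ) / 2 - 1) = (t ^ 2)⁻¹ := by
      rw [show (-(2 : ℝ) / 2 - 1) = -(2 : ℕ) by norm_num, Real.rpow_neg (le_of_lt ht),
        Real.rpow_natCast]
    simp only [hm, hΦ, h2, regGauss]
    field_simp
    ring_nf
  have hz : ∀ t, regGauss (fun _ => 1) (fun t => -(t * Real.exp (-t))) t 0 = 0 := by
    simp [regGauss]
  have hlog : ∀ x : Space d, Real.log (‖x‖ ^ 2 / 1) = 2 * Real.log ‖x‖ := by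
    intro x
    rw [div_one, Real.log_pow]
    push_cast; rfl
  have H : Represents 2 (fun x : Space d => ‖x‖ ^ (2 : ℝ) * I + 2 * (‖x‖ ^ (2 : ℝ) * Real.log ‖x‖))
      (logBound d 2) _ :=
    represents_mixture (m := m) (q₀ := fun _ => 1) (q₁ := fun t => -(t * Real.exp (-t)))
    (by fun_prop) (by fun_prop) (by fun_prop)
    (fun t => ⟨fun h => by simp at h, fun h => by simp at h⟩)
    (by fun_prop) (measurable_logBound 2) (C := (I' + 2).toNNReal) (fun x hx => by
      rcases eq_or_ne x 0 with rfl | h0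
      · simp [hz]
      have hr := norm_pos_iff.2 h0
      have i₁ := integrableOn_profile hr hf
      have i₂ := (integrableOn_frullani one_pos (pow_pos hr 2)).const_mul (‖x‖ ^ 2)
      rw [setLIntegral_congr_fun measurableSet_Ioi fun t ht => by rw [e ‖x‖ t ht]]
      refine (lintegral_mono fun t => enorm_add_le _ _).trans ?_
      rw [lintegral_add_left' i₁.1.enorm, lintegral_profile hr hf]
      simp_rw [enorm_mul (‖x‖ ^ 2)]
      rw [lintegral_const_mul' _ _ enorm_ne_top, lintegral_frullani one_pos (pow_pos hr 2),
        hlog, logBound_of_ne h0, Real.enorm_of_nonneg (by positivity),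
        ← ENNReal.ofReal_mul (by positivity),
        ← ENNReal.ofReal_add (mul_nonneg (by positivity) hI') (by positivity)]
      change _ ≤ ENNReal.ofReal (I' + 2) * _
      rw [← ENNReal.ofReal_mul (by positivity)]
      refine ENNReal.ofReal_le_ofReal ?_
      rw [abs_mul, Real.rpow_two, abs_of_pos (two_pos : (0 : ℝ) < 2)]
      have h2 : 0 ≤ ‖x‖ ^ 2 := by positivity
      nlinarith [mul_nonneg (mul_nonneg hI' h2) (abs_nonneg (Real.log ‖x‖))]) (fun x hx => by
      rcases eq_or_ne x 0 with rfl | h0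
      · simp [hz]
      have hr := norm_pos_iff.2 h0
      have i₁ := integrableOn_profile hr hf
      have i₂ := (integrableOn_frullani one_pos (pow_pos hr 2)).const_mul (‖x‖ ^ 2)
      rw [setIntegral_congr_fun measurableSet_Ioi fun t ht => e ‖x‖ t ht, integral_add i₁ i₂,
        integral_profile hr, integral_const_mul, integral_frullani one_pos (pow_pos hr 2), hlog,
        Real.rpow_two]
      ring)
  obtain ⟨w, Hsq⟩ := represents_sq (d := d)
  exact ⟨_, ((H.const_mul (1 / 2)).add ((Hsq.mono_bound (measurable_logBound 2) 1
    (powBound_le_logBound 2)).const_mul (-I / 2))).congr_kernel fun x => by ring⟩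

/-! ### Decay of the dominating kernels -/

lemma integrable_norm_rpow_mul_log (hd : 0 < d) {b : ℝ} {N : ℕ} (hb : -(d : ℝ) < b)
    (hN : b + d < N) : Integrable fun x : Space d =>
      ‖x‖ ^ b * (1 + |Real.log ‖x‖|) * (1 + ‖x‖) ^ (-(N : ℝ)) := by
  have : Nonempty (Fin d) := ⟨⟨0, hd⟩⟩
  have hpos : ∀ s : ℝ, 0 < 1 + |s| := fun s => by positivity
  have hcont : Continuous fun s : ℝ => (1 + |s|) ^ (-(N : ℝ)) :=
    Continuous.rpow_const (by fun_prop) fun s => Or.inl (hpos s).ne'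
  -- This parameter turns the Mellin weight into s^(b+d-1), that is s^b times the polar Jacobian
  -- s^(d-1). Convergence at 0 is b + d > 0 and at infinity b + d < N.
  obtain ⟨hf, hg⟩ := mellin_profile_integrable (b := -2 * (b + d)) (e₀ := (0 : ℕ))
    (e₁ := -(N : ℝ)) (Φ := fun s => (1 + |s|) ^ (-(N : ℝ))) hcont
    (isBigO_rpow_nhdsGT 1 0 fun s hs _ => by
      rw [abs_of_nonneg (by positivity), pow_zero, mul_one, abs_of_pos hs]
      exact Real.rpow_le_one_of_one_le_of_nonpos (by linarith) (by simp))
    (by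
      refine IsBigO.of_bound 1 ?_
      filter_upwards [eventually_ge_atTop 1] with s hs
      have hs0 : 0 < s := by linarith
      rw [Real.norm_of_nonneg (by positivity), Real.norm_of_nonneg (by positivity), one_mul,
        abs_of_pos hs0]
      exact Real.rpow_le_rpow_of_nonpos hs0 (by linarith) (by simp))
    (by push_cast; linarith) (by linarith)
  have h := (hf.add hg.norm)
  refine ((integrable_fun_norm_addHaar (volume : Measure (Space d)) (f := fun y : ℝ =>
    y ^ b * (1 + |Real.log y|) * (1 + y) ^ (-(N : ℝ)))).2 ?_)
  refine IntegrableOn.congr_fun h (fun y hy => ?_) measurableSet_Ioi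
  have hy' : 0 < y := hy
  have e : y ^ (-(-2 * (b + d)) / 2 - 1) = y ^ (d - 1) * y ^ b := by
    rw [← Real.rpow_natCast, ← Real.rpow_add hy', Nat.cast_sub (by omega)]
    congr 1
    push_cast
    ring
  simp only [Pi.add_apply, finrank_euclideanSpace, Fintype.card_fin, smul_eq_mul, e,
    abs_of_pos hy', norm_mul, Real.norm_eq_abs]
  rw [abs_of_nonneg (show 0 ≤ y ^ (d - 1) * y ^ b by positivity),
    abs_of_nonneg (show 0 ≤ (1 + y) ^ (-(N : ℝ)) by positivity)]
  ring

lemma lintegral_logBound_lt_top (hd : 0 < d) {b : ℝ} {N : ℕ} (hb : -(d : ℝ) < b)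
    (hN : b + d < N) :
    ∫⁻ x : Space d, logBound d b x * ENNReal.ofReal ((1 + ‖x‖) ^ (-(N : ℝ))) < ⊤ := by
  have : Nonempty (Fin d) := ⟨⟨0, hd⟩⟩
  refine lt_of_le_of_lt (le_of_eq ?_) (integrable_norm_rpow_mul_log hd hb hN).lintegral_lt_top
  refine lintegral_congr_ae ?_
  have : ∀ᵐ x : Space d, x ≠ 0 := by simp [ae_iff]
  filter_upwards [this] with x hx
  rw [logBound_of_ne hx, ← ENNReal.ofReal_mul (by positivity)]

/-! ### Radial potentials -/

lemma exists_bound_of_isBigO {f V : ℝ → ℝ} (hf : ContinuousOn f (Ioi 0))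
    (hO : f =O[𝓝[>] 0] fun r => 1 + max (V r) 0) (R : ℝ) :
    ∃ C : ℝ, 0 < C ∧ ∀ r, 0 < r → r ≤ R → f r ≤ C * (1 + max (V r) 0) := by
  obtain ⟨C₁, hC₁, h₁⟩ := hO.exists_pos
  obtain ⟨δ, hδ, h₂⟩ := mem_nhdsGT_iff_exists_Ioo_subset.1 h₁.bound
  have hδ' : 0 < δ := hδ
  obtain ⟨C₂, h₃⟩ := (isCompact_Icc (a := δ) (b := R)).exists_bound_of_continuousOn
    (hf.mono fun r hr => hδ'.trans_le hr.1)
  refine ⟨C₁ + |C₂|, by positivity, fun r hr hrR => ?_⟩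
  have hV : 0 ≤ max (V r) 0 := le_max_right _ _
  rcases lt_or_ge r δ with h | h
  · have := h₂ ⟨hr, h⟩
    simp only [mem_ofPred_eq] at this
    rw [Real.norm_of_nonneg (show 0 ≤ 1 + max (V r) 0 by positivity)] at this
    refine (le_abs_self _).trans (this.trans ?_)
    gcongr
    linarith [abs_nonneg C₂]
  · refine (le_abs_self _).trans ((h₃ r ⟨h, hrR⟩).trans ?_)
    nlinarith [le_abs_self C₂, mul_nonneg (add_nonneg hC₁.le (abs_nonneg C₂)) hV]

lemma tendsto_atTop_of_isBigO {f V : ℝ → ℝ} (hO : f =O[𝓝[>] 0] fun r => 1 + max (V r) 0)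
    (hf : Tendsto f (𝓝[>] 0) atTop) : Tendsto V (𝓝[>] 0) atTop := by
  obtain ⟨C, hC, h⟩ := hO.exists_pos
  rw [tendsto_atTop]
  intro M
  filter_upwards [h.bound, hf.eventually_gt_atTop (C * (1 + |M|))] with r h₁ h₂
  have hV : 0 ≤ max (V r) 0 := le_max_right _ _
  rw [Real.norm_of_nonneg (show 0 ≤ 1 + max (V r) 0 by positivity)] at h₁
  have h₃ : 1 + |M| < 1 + max (V r) 0 :=
    lt_of_mul_lt_mul_left (h₂.trans_le ((le_abs_self _).trans h₁)) hC.le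
  have h₄ : |M| < max (V r) 0 := by linarith
  rcases lt_max_iff.1 h₄ with h | h
  · exact (le_abs_self M).trans h.le
  · exact absurd h (not_lt.2 (abs_nonneg M))

lemma locallyIntegrable_of_weight {V : Space d → ℝ} (hV : Measurable V) {N : ℕ}
    (h : Integrable fun x => ‖V x‖ * (1 + ‖x‖) ^ (-(N : ℝ))) : LocallyIntegrable V := by
  rw [locallyIntegrable_iff]
  intro K hK
  have hc : Continuous fun x : Space d => (1 + ‖x‖) ^ (N : ℝ) := by
    simp only [Real.rpow_natCast]; fun_prop
  have := (h.integrableOn (s := K)).mul_continuousOn hc.continuousOn hK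
  refine (integrable_norm_iff hV.aestronglyMeasurable).1 (this.congr
    (Eventually.of_forall fun x => ?_))
  simp only
  rw [mul_assoc, ← Real.rpow_add (by positivity)]
  simp

/-- W is continuous into the extended reals, since its value at 0 is its limit there; lower bounds
on compact sets come from an attained minimum. -/
theorem isPotential_radial (hd : 0 < d) {W : Space d → EReal} {V : ℝ → ℝ}
    (hV : ContinuousOn V (Ioi 0)) (hW : ∀ x, x ≠ 0 → W x = (V ‖x‖ : EReal))
    (h0 : Tendsto (fun r => (V r : EReal)) (𝓝[>] 0) (𝓝 (W 0))) (hbot : W 0 ≠ ⊥)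
    (hint : LocallyIntegrable fun x => (W x).toReal) : IsPotential W := by
  have : Nonempty (Fin d) := ⟨⟨0, hd⟩⟩
  have hcont : Continuous W := by
    rw [continuous_iff_continuousAt]
    intro x
    rcases eq_or_ne x 0 with rfl | hx
    · rw [← continuousWithinAt_compl_self]
      refine Tendsto.congr' (f₁ := fun x : Space d => (V ‖x‖ : EReal)) ?_
        (h0.comp tendsto_norm_nhdsNE_zero)
      filter_upwards [self_mem_nhdsWithin] with y hy
      exact (hW y hy).symm
    · have h1 : ContinuousAt (fun x : Space d => (V ‖x‖ : EReal)) x :=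
        continuous_coe_real_ereal.continuousAt.comp
          (ContinuousAt.comp (g := V) (hV.continuousAt (Ioi_mem_nhds (norm_pos_iff.2 hx)))
          continuous_norm.continuousAt)
      refine h1.congr ?_
      filter_upwards [isOpen_compl_singleton.mem_nhds hx] with y hy
      exact (hW y hy).symm
  have hnb : ∀ x, W x ≠ ⊥ := by
    intro x
    rcases eq_or_ne x 0 with rfl | hx
    · exact hbot
    · rw [hW x hx]; exact EReal.coe_ne_bot _
  refine ⟨?_, hint, fun K hK => ?_, hcont.lowerSemicontinuous, fun x => ?_⟩
  · have : ∀ᵐ x : Space d, x ≠ 0 := by simp [ae_iff]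
    filter_upwards [this] with x hx
    rw [hW x hx]; exact EReal.coe_ne_top _
  · rcases K.eq_empty_or_nonempty with rfl | hne
    · exact ⟨0, by simp⟩
    obtain ⟨a, -, hmin⟩ := hK.exists_isMinOn hne hcont.continuousOn
    by_cases htop : W a = ⊤
    · refine ⟨0, fun x hx => ?_⟩
      have := hmin hx
      rw [mem_ofPred_eq, htop, top_le_iff] at this
      rw [this]; exact le_top
    · refine ⟨(W a).toReal, fun x hx => ?_⟩
      rw [EReal.coe_toReal htop (hnb a)]
      exact hmin hx
  · rcases eq_or_ne x 0 with rfl | hx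
    · rw [neg_zero]
    · rw [hW x hx, hW _ (neg_ne_zero.2 hx), norm_neg]

/-- The profile f of κ serves two purposes: its domination by 1 + V⁺ near 0 lets the energy control
κ, and, when f blows up, forces V to do so too. In the singular case V 0 = 0 is required to match
the real part assigned to ⊤. -/
theorem fourierRepresentable_radial (hd : 0 < d) {k : ℕ} {W : Space d → EReal}
    {κ : Space d → ENNReal} {w : Space d → ℝ} {f V : ℝ → ℝ}
    (H : Represents k (fun x => V ‖x‖) κ w) {N : ℕ}
    (hN : ∫⁻ x, κ x * ENNReal.ofReal ((1 + ‖x‖) ^ (-(N : ℝ))) < ⊤)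
    (hV : ContinuousOn V (Ioi 0)) (hf : ContinuousOn f (Ioi 0))
    (hW : ∀ x, x ≠ 0 → W x = (V ‖x‖ : EReal))
    (hκ : ∀ x, x ≠ 0 → κ x ≤ ENNReal.ofReal (f ‖x‖))
    (hO : f =O[𝓝[>] 0] fun r => 1 + max (V r) 0)
    (h0 : (W 0 = ⊤ ∧ V 0 = 0 ∧ Tendsto f (𝓝[>] 0) atTop) ∨
      (W 0 = V 0 ∧ κ 0 = 0 ∧ Tendsto V (𝓝[>] 0) (𝓝 (V 0)))) :
    FourierRepresentable k W := by
  have htoReal : ∀ x, V ‖x‖ = (W x).toReal := by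
    intro x
    rcases eq_or_ne x 0 with rfl | hx
    · rcases h0 with ⟨h, h', -⟩ | ⟨h, -⟩ <;> simp [h]
      rw [h']
    · rw [hW x hx, EReal.toReal_coe]
  have hlim : Tendsto (fun r => (V r : EReal)) (𝓝[>] 0) (𝓝 (W 0)) := by
    rcases h0 with ⟨h, -, h'⟩ | ⟨h, -, h'⟩
    · rw [h, EReal.tendsto_coe_nhds_top_iff]
      exact tendsto_atTop_of_isBigO hO h'
    · rw [h]
      exact (continuous_coe_real_ereal.tendsto _).comp h'
  have hbot : W 0 ≠ ⊥ := by
    rcases h0 with ⟨h, -⟩ | ⟨h, -⟩ <;> simp [h]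
  have H' := H.congr_kernel htoReal
  refine fourierRepresentable_of_represents hd (isPotential_radial hd hV hW hlim hbot
    (locallyIntegrable_of_weight H'.measurable_kernel (H'.integrable_weight hN))) H' hN
    fun R => ?_
  obtain ⟨C, hC, h⟩ := exists_bound_of_isBigO hf hO R
  refine ⟨C.toNNReal, fun x hx => ?_⟩
  rcases eq_or_ne x 0 with rfl | hx0
  · rcases h0 with ⟨h', -⟩ | ⟨-, h', -⟩
    · rw [h', EReal.toENNReal_top, add_top, ENNReal.mul_top]
      · exact le_top
      · simpa using hC
    · rw [h']; exact zero_le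
  · refine (hκ x hx0).trans ((ENNReal.ofReal_le_ofReal
      (h ‖x‖ (norm_pos_iff.2 hx0) hx)).trans (le_of_eq ?_))
    rw [ENNReal.ofReal_mul hC.le, ENNReal.ofReal_add zero_le_one (le_max_right _ _), hW x hx0,
      EReal.toENNReal_of_ne_top (EReal.coe_ne_top _), EReal.toReal_coe, ENNReal.ofReal_one,
      ENNReal.ofReal_max]
    simp [ENNReal.ofReal]

/-! ### The profiles of the power-law potentials near the origin -/

/-- A radial profile dominating `powQuot c`. -/
def quotProfile (c r : ℝ) : ℝ := if c = 0 then 1 + |Real.log r| else r ^ c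

/-- The kernel on `ℝ^d` with profile `quotProfile c`. -/
def quotBound (d : ℕ) (c : ℝ) (x : Space d) : ENNReal :=
  if c = 0 then logBound d 0 x else powBound d c x

lemma measurable_quotBound (c : ℝ) : Measurable (quotBound d c) := by
  unfold quotBound
  split_ifs
  · exact measurable_logBound 0
  · exact measurable_powBound c

lemma quotBound_le_logBound (c : ℝ) (x : Space d) : quotBound d c x ≤ logBound d c x := by
  unfold quotBound
  split_ifs with h
  · rw [h]
  · simpa using powBound_le_logBound c x

lemma quotBound_of_ne {c : ℝ} {x : Space d} (hx : x ≠ 0) :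
    quotBound d c x = ENNReal.ofReal (quotProfile c ‖x‖) := by
  unfold quotBound quotProfile
  split_ifs
  · rw [logBound_of_ne hx, Real.rpow_zero, one_mul]
  · rw [powBound_of_ne hx]

lemma quotBound_zero_of_pos {c : ℝ} (hc : 0 < c) : quotBound d c 0 = 0 := by
  simp [quotBound, powBound, hc.ne', hc.not_ge, Real.zero_rpow]

lemma logBound_zero_of_pos {c : ℝ} (hc : 0 < c) : logBound d c 0 = 0 := by
  simp [logBound, hc.ne', hc.not_ge, Real.zero_rpow]

lemma powQuot_zero (c : ℝ) : powQuot c 0 = 0 := by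
  unfold powQuot
  split_ifs with h
  · simp
  · simp [Real.zero_rpow h]

lemma continuousOn_powQuot (c : ℝ) : ContinuousOn (powQuot c) (Ioi 0) := by
  intro r hr
  have hr' : r ≠ 0 := (mem_Ioi.1 hr).ne'
  unfold powQuot
  split_ifs
  · exact (Real.continuousAt_log hr').continuousWithinAt
  · exact ((Real.continuousAt_rpow_const r c (.inl hr')).div_const c).continuousWithinAt

lemma continuousOn_quotProfile (c : ℝ) : ContinuousOn (quotProfile c) (Ioi 0) := by
  intro r hr
  have hr' : r ≠ 0 := (mem_Ioi.1 hr).ne'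
  unfold quotProfile
  split_ifs
  · exact (continuousAt_const.add (Real.continuousAt_log hr').abs).continuousWithinAt
  · exact (Real.continuousAt_rpow_const r c (.inl hr')).continuousWithinAt

lemma quotProfile_nonneg {c r : ℝ} (hr : 0 < r) : 0 ≤ quotProfile c r := by
  unfold quotProfile
  split_ifs <;> positivity

lemma tendsto_rpow_nhdsGT_zero {c : ℝ} (hc : 0 < c) :
    Tendsto (fun r : ℝ => r ^ c) (𝓝[>] 0) (𝓝 0) := by
  have h := (Real.continuousAt_rpow_const 0 c (.inr hc.le)).tendsto
  rw [Real.zero_rpow hc.ne'] at h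
  exact h.mono_left nhdsWithin_le_nhds

lemma tendsto_powQuot_nhdsGT_zero {c : ℝ} (hc : 0 < c) :
    Tendsto (powQuot c) (𝓝[>] 0) (𝓝 0) := by
  have h := (tendsto_rpow_nhdsGT_zero hc).div_const c
  rw [zero_div] at h
  exact h.congr fun r => by simp [powQuot, hc.ne']

lemma tendsto_quotProfile_nhdsGT_zero {c : ℝ} (hc : 0 < c) :
    Tendsto (quotProfile c) (𝓝[>] 0) (𝓝 0) :=
  (tendsto_rpow_nhdsGT_zero hc).congr fun r => by simp [quotProfile, hc.ne']

lemma tendsto_abs_log_nhdsGT_zero : Tendsto (fun r => |Real.log r|) (𝓝[>] 0) atTop :=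
  tendsto_abs_atBot_atTop.comp Real.tendsto_log_nhdsGT_zero

lemma tendsto_quotProfile_atTop {c : ℝ} (hc : c ≤ 0) :
    Tendsto (quotProfile c) (𝓝[>] 0) atTop := by
  unfold quotProfile
  split_ifs with h
  · exact tendsto_atTop_add_const_left _ _ tendsto_abs_log_nhdsGT_zero
  · exact tendsto_rpow_neg_nhdsGT_zero (lt_of_le_of_ne hc h)

lemma powQuot_isBigO_quotProfile (c : ℝ) : powQuot c =O[𝓝[>] 0] quotProfile c := by
  refine IsBigO.of_bound (max 1 |c|⁻¹) ?_
  filter_upwards [self_mem_nhdsWithin] with r hr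
  have hr : 0 < r := hr
  rw [Real.norm_eq_abs, Real.norm_of_nonneg (quotProfile_nonneg hr)]
  unfold powQuot quotProfile
  split_ifs
  · refine (le_add_of_nonneg_left zero_le_one).trans
      (le_mul_of_one_le_left (by positivity) (le_max_left _ _))
  · rw [abs_div, abs_of_nonneg (by positivity : 0 ≤ r ^ c), div_eq_inv_mul]
    gcongr
    exact le_max_right _ _

lemma quotProfile_isBigO_one_add_max {c : ℝ} (hc : c ≤ 0) :
    quotProfile c =O[𝓝[>] 0] fun r => 1 + max (-powQuot c r) 0 := by
  refine IsBigO.of_bound (max 1 |c|) ?_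
  filter_upwards [Ioo_mem_nhdsGT (zero_lt_one' ℝ)] with r hr
  have hr0 : 0 < r := hr.1
  have hm := le_max_right (-powQuot c r) 0
  rw [Real.norm_of_nonneg (quotProfile_nonneg hr0), Real.norm_of_nonneg (by positivity)]
  unfold powQuot quotProfile at *
  split_ifs at * with h
  · have := Real.log_nonpos hr0.le hr.2.le
    rw [abs_of_nonpos this, max_eq_left (neg_nonneg.2 this)]
    exact le_mul_of_one_le_left (by linarith) (le_max_left _ _)
  · have hc' : c < 0 := lt_of_le_of_ne hc h
    have h₁ := le_max_left (-(r ^ c / c)) 0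
    calc r ^ c = |c| * (-(r ^ c / c)) := by rw [abs_of_neg hc']; field_simp
      _ ≤ |c| * (1 + max (-(r ^ c / c)) 0) := by gcongr; linarith
      _ ≤ max 1 |c| * (1 + max (-(r ^ c / c)) 0) := by
        gcongr
        exact le_max_right _ _

lemma quotProfile_isLittleO {a b : ℝ} (hba : b < a) (hb : b ≤ 0) :
    quotProfile a =o[𝓝[>] 0] quotProfile b := by
  have hone : (fun _ => (1 : ℝ)) =o[𝓝[>] 0] quotProfile b :=
    (isLittleO_const_left.2 (.inr
      (tendsto_norm_atTop_atTop.comp (tendsto_quotProfile_atTop hb))))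
  rcases lt_trichotomy a 0 with ha | rfl | ha
  · have hb' : b < 0 := hba.trans ha
    have e (c : ℝ) (hc : c < 0) : quotProfile c = fun r => r ^ c := by
      ext r; simp [quotProfile, hc.ne]
    rw [e a ha, e b hb']
    have h : (fun r : ℝ => r ^ (a - b)) =o[𝓝[>] 0] fun _ => (1 : ℝ) :=
      (isLittleO_one_iff ℝ).2 (tendsto_rpow_nhdsGT_zero (sub_pos.2 hba))
    refine (h.mul_isBigO (isBigO_refl (fun r : ℝ => r ^ b) _)).congr' ?_ ?_
    · filter_upwards [self_mem_nhdsWithin] with r hr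
      rw [← Real.rpow_add hr, sub_add_cancel]
    · simp
  · have e : quotProfile b = fun r => r ^ b := by ext r; simp [quotProfile, hba.ne]
    have h := (isLittleO_log_rpow_nhdsGT_zero hba).norm_left
    rw [← e] at h
    exact (hone.add h).congr_left fun r => by simp [quotProfile]
  · exact ((tendsto_quotProfile_nhdsGT_zero ha).isBigO_one ℝ).trans_isLittleO hone

lemma isBigO_one_add_max_of_tendsto {f V : ℝ → ℝ} {l : Filter ℝ} {y : ℝ}
    (hf : Tendsto f l (𝓝 y)) : f =O[l] fun r => 1 + max (V r) 0 := by
  refine (hf.isBigO_one ℝ).trans (IsBigO.of_bound 1 (Eventually.of_forall fun r => ?_))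
  have := le_max_right (V r) 0
  rw [norm_one, one_mul, Real.norm_of_nonneg (by positivity)]
  linarith

/-- Since (-B)⁺ ≤ (A - B)⁺ + |A| and |A| is eventually at most half of 1 + (-B)⁺, that half is
absorbed on the left, which costs the factor 2. -/
lemma isBigO_one_add_max_of_isLittleO {A B : ℝ → ℝ} {l : Filter ℝ}
    (h : A =o[l] fun r => 1 + max (-B r) 0) :
    (fun r => 1 + max (-B r) 0) =O[l] fun r => 1 + max (A r - B r) 0 := by
  refine IsBigO.of_bound 2 ?_
  filter_upwards [h.bound (c := 1 / 2) (by norm_num)] with r hr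
  have h₁ := le_max_right (-B r) 0
  have h₂ := le_max_right (A r - B r) 0
  have h₃ := le_max_left (A r - B r) 0
  rw [Real.norm_eq_abs, Real.norm_of_nonneg (by positivity)] at hr
  rw [Real.norm_of_nonneg (by positivity), Real.norm_of_nonneg (by positivity)]
  have h₄ := neg_abs_le (A r)
  have h₅ : max (-B r) 0 ≤ max (A r - B r) 0 + |A r| :=
    max_le (by linarith) (by positivity)
  linarith

/-! ### Representation of the power laws -/

lemma exists_represents_powQuot {c : ℝ} (hc : c < 4) :
    ∃ w, Represents (powerLevel c) (fun x : Space d => powQuot c ‖x‖) (quotBound d c) w := by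
  have scale {k : ℕ} (h0 : c ≠ 0)
      (H : ∃ w, Represents k (fun x : Space d => ‖x‖ ^ c) (powBound d c) w) :
      ∃ w, Represents k (fun x : Space d => powQuot c ‖x‖) (quotBound d c) w := by
    obtain ⟨w, H⟩ := H
    have e : quotBound d c = powBound d c := by ext x; simp [quotBound, h0]
    rw [e]
    exact ⟨_, (H.const_mul (1 / c)).congr_kernel fun x => by simp [powQuot, h0]; ring⟩
  unfold powerLevel
  split_ifs with h h'
  · exact scale h.ne (represents_power_neg h).1
  · rcases (not_lt.1 h).eq_or_lt with rfl | h0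
    · obtain ⟨w, H⟩ := represents_log (d := d)
      have e : quotBound d 0 = logBound d 0 := by ext x; simp [quotBound]
      rw [e]
      exact ⟨w, H.congr_kernel fun x => by simp [powQuot]⟩
    · exact scale h0.ne' (represents_power_one h0 h').1
  · rcases (not_lt.1 h').eq_or_lt with rfl | h2
    · exact scale two_ne_zero represents_sq
    · exact scale (by positivity) (represents_power_two h2 hc).1

lemma powerLevel_le_two (c : ℝ) : powerLevel c ≤ 2 := by
  unfold powerLevel
  split_ifs <;> norm_num

lemma exists_represents_rpow_mul_log {b : ℝ} (hb : b < 4) (hb0 : b ≠ 0) :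
    ∃ w, Represents (powerLevel b) (fun x : Space d => ‖x‖ ^ b * Real.log ‖x‖)
      (logBound d b) w := by
  unfold powerLevel
  split_ifs with h h'
  · exact (represents_power_neg h).2
  · exact (represents_power_one (lt_of_le_of_ne (not_lt.1 h) hb0.symm) h').2
  · rcases (not_lt.1 h').eq_or_lt with rfl | h2
    · exact represents_sq_mul_log
    · exact (represents_power_two h2 hb).2

lemma lintegral_quotBound_lt_top (hd : 0 < d) {c : ℝ} (hc : -(d : ℝ) < c) (hc4 : c < 4) :
    ∫⁻ x : Space d, quotBound d c x * ENNReal.ofReal ((1 + ‖x‖) ^ (-((d + 4 : ℕ) : ℝ))) < ⊤ :=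
  (lintegral_mono fun x => mul_le_mul_left (quotBound_le_logBound c x) _).trans_lt
    -- Decay of order d + 4 suffices for all exponents at once, because c < 4.
    (lintegral_logBound_lt_top hd hc (by push_cast; linarith))

/-! ### Fourier representability of the three families -/

theorem fourierRepresentable_powerPotential (hd : 0 < d) {b : ℝ} (hb : -(d : ℝ) < b)
    (hb4 : b < 4) : FourierRepresentable (powerLevel b) (powerPotential d b) := by
  obtain ⟨w, H⟩ := exists_represents_powQuot (d := d) hb4
  refine fourierRepresentable_radial hd (V := fun r => -powQuot b r) (f := quotProfile b)
    ((H.const_mul (-1)).congr_kernel fun x => by ring) (lintegral_quotBound_lt_top hd hb hb4)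
    (continuousOn_powQuot b).neg (continuousOn_quotProfile b)
    (fun x hx => by simp [powerPotential, hx]) (fun x hx => (quotBound_of_ne hx).le) ?_ ?_
  · rcases le_or_gt b 0 with h | h
    · exact quotProfile_isBigO_one_add_max h
    · exact isBigO_one_add_max_of_tendsto (tendsto_quotProfile_nhdsGT_zero h)
  · rcases le_or_gt b 0 with h | h
    · exact .inl ⟨by simp [powerPotential, h], by simp [powQuot_zero],
        tendsto_quotProfile_atTop h⟩
    · refine .inr ⟨by simp [powerPotential, h.not_ge], quotBound_zero_of_pos h, ?_⟩
      simpa [powQuot_zero] using (tendsto_powQuot_nhdsGT_zero h).neg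

/-- Both powers are lifted to level 2 with the sum of their bounds as common κ. If b ≤ 0, the
attractive term is negligible near 0 and the positive part of W still controls κ; if b > 0, κ is
bounded there. -/
theorem fourierRepresentable_attrRepPotential (hd : 0 < d) {a b : ℝ} (hb : -(d : ℝ) < b)
    (hba : b < a) (ha : a < 4) : FourierRepresentable 2 (attrRepPotential d a b) := by
  obtain ⟨w₁, H₁⟩ := exists_represents_powQuot (d := d) ha
  obtain ⟨w₂, H₂⟩ := exists_represents_powQuot (d := d) (hba.trans ha)
  have hm : Measurable fun x => quotBound d a x + quotBound d b x :=
    (measurable_quotBound a).add (measurable_quotBound b)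
  have H := ((H₁.mono_level (powerLevel_le_two a)).mono_bound hm 1 fun x => by simp).add
    (((H₂.mono_level (powerLevel_le_two b)).mono_bound hm 1 fun x => by simp).const_mul (-1))
  refine fourierRepresentable_radial hd (V := fun r => powQuot a r - powQuot b r)
    (f := fun r => quotProfile a r + quotProfile b r) (N := d + 4)
    (H.congr_kernel fun x => by ring) ?_
    ((continuousOn_powQuot a).sub (continuousOn_powQuot b))
    ((continuousOn_quotProfile a).add (continuousOn_quotProfile b))
    (fun x hx => by simp [attrRepPotential, hx]) (fun x hx => ?_) ?_ ?_
  · simp_rw [add_mul]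
    rw [lintegral_add_left (f := fun x => quotBound d a x * _)
      ((measurable_quotBound a).mul (by fun_prop))]
    exact ENNReal.add_lt_top.2 ⟨lintegral_quotBound_lt_top hd (hb.trans hba) ha,
      lintegral_quotBound_lt_top hd hb (hba.trans ha)⟩
  · rw [quotBound_of_ne hx, quotBound_of_ne hx, ENNReal.ofReal_add
      (quotProfile_nonneg (norm_pos_iff.2 hx)) (quotProfile_nonneg (norm_pos_iff.2 hx))]
  · rcases le_or_gt b 0 with h | h
    · have hB := quotProfile_isBigO_one_add_max h
      have hl := quotProfile_isLittleO hba h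
      exact (hl.isBigO.add (isBigO_refl _ _)).trans (hB.trans (isBigO_one_add_max_of_isLittleO
        (((powQuot_isBigO_quotProfile a).trans_isLittleO hl).trans_isBigO hB)))
    · exact isBigO_one_add_max_of_tendsto ((tendsto_quotProfile_nhdsGT_zero (h.trans hba)).add
        (tendsto_quotProfile_nhdsGT_zero h))
  · rcases le_or_gt b 0 with h | h
    · refine .inl ⟨by simp [attrRepPotential, h], by simp [powQuot_zero], ?_⟩
      refine tendsto_atTop_mono' _ ?_ (tendsto_quotProfile_atTop h)
      filter_upwards [self_mem_nhdsWithin] with r hr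
      exact le_add_of_nonneg_left (quotProfile_nonneg hr)
    · refine .inr ⟨by simp [attrRepPotential, h.not_ge], ?_, ?_⟩
      · rw [quotBound_zero_of_pos (h.trans hba), quotBound_zero_of_pos h, add_zero]
      · simpa [powQuot_zero] using
          (tendsto_powQuot_nhdsGT_zero (h.trans hba)).sub (tendsto_powQuot_nhdsGT_zero h)

lemma tendsto_rpow_mul_log_nhdsGT_zero {b : ℝ} (hb : 0 < b) :
    Tendsto (fun r : ℝ => r ^ b * Real.log r) (𝓝[>] 0) (𝓝 0) :=
  (tendsto_log_mul_rpow_nhdsGT_zero hb).congr fun _ => mul_comm _ _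

lemma rpow_mul_one_add_abs_log_isBigO {b : ℝ} (hb : b < 0) :
    (fun r : ℝ => r ^ b * (1 + |Real.log r|)) =O[𝓝[>] 0]
      fun r => 1 + max (r ^ b / b * Real.log r) 0 := by
  refine IsBigO.of_bound (2 * |b|) ?_
  -- Below exp(-1) one has 1 ≤ |log r|, which gives the factor 2; b and log r are both negative, so
  -- the potential is positive.
  filter_upwards [Ioo_mem_nhdsGT (Real.exp_pos (-1))] with r hr
  have hr0 : 0 < r := hr.1
  have hlog : Real.log r ≤ -1 := (Real.log_le_iff_le_exp hr0).2 hr.2.le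
  have hp : 0 < r ^ b := Real.rpow_pos_of_pos hr0 b
  have hm := le_max_right (r ^ b / b * Real.log r) 0
  rw [Real.norm_of_nonneg (by positivity), Real.norm_of_nonneg (by positivity)]
  calc r ^ b * (1 + |Real.log r|) ≤ r ^ b * (2 * |Real.log r|) := by
        rw [abs_of_neg (by linarith : Real.log r < 0)]
        gcongr
        linarith
    _ = 2 * |b| * (r ^ b / b * Real.log r) := by
        rw [abs_of_neg hb, abs_of_neg (by linarith : Real.log r < 0)]
        field_simp [hb.ne]
    _ ≤ 2 * |b| * (1 + max (r ^ b / b * Real.log r) 0) := by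
        gcongr
        exact (le_max_left _ _).trans (le_add_of_nonneg_left zero_le_one)

theorem fourierRepresentable_logPowerPotential (hd : 0 < d) {b : ℝ} (hb : -(d : ℝ) < b)
    (hb0 : b ≠ 0) (hb4 : b < 4) :
    FourierRepresentable (powerLevel b) (logPowerPotential d b) := by
  obtain ⟨w, H⟩ := exists_represents_rpow_mul_log (d := d) hb4 hb0
  have hpow : ContinuousOn (fun r : ℝ => r ^ b) (Ioi 0) := fun r hr =>
    (Real.continuousAt_rpow_const r b (.inl (mem_Ioi.1 hr).ne')).continuousWithinAt
  have hlog : ContinuousOn Real.log (Ioi 0) :=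
    Real.continuousOn_log.mono fun _ hr => (mem_Ioi.1 hr).ne'
  have hprof : 0 < b → Tendsto (fun r : ℝ => r ^ b * (1 + |Real.log r|)) (𝓝[>] 0) (𝓝 0) := by
    intro h
    have h₁ := (tendsto_rpow_nhdsGT_zero h).add (tendsto_rpow_mul_log_nhdsGT_zero h).abs
    rw [abs_zero, add_zero] at h₁
    refine h₁.congr' ?_
    filter_upwards [self_mem_nhdsWithin] with r hr
    rw [abs_mul, abs_of_pos (Real.rpow_pos_of_pos hr b)]
    ring
  refine fourierRepresentable_radial hd (V := fun r => r ^ b / b * Real.log r)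
    (f := fun r => r ^ b * (1 + |Real.log r|)) (N := d + 4)
    ((H.const_mul (1 / b)).congr_kernel fun x => by ring)
    (lintegral_logBound_lt_top hd hb (by push_cast; linarith))
    ((hpow.div_const b).mul hlog) (hpow.mul (continuousOn_const.add hlog.abs))
    (fun x hx => by simp [logPowerPotential, hx]) (fun x hx => (logBound_of_ne hx).le) ?_ ?_
  · rcases lt_or_gt_of_ne hb0 with h | h
    · exact rpow_mul_one_add_abs_log_isBigO h
    · exact isBigO_one_add_max_of_tendsto (hprof h)
  · rcases lt_or_gt_of_ne hb0 with h | h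
    · refine .inl ⟨by simp [logPowerPotential, h], by simp, ?_⟩
      exact (tendsto_rpow_neg_nhdsGT_zero h).atTop_mul_atTop₀
        (tendsto_atTop_add_const_left _ _ tendsto_abs_log_nhdsGT_zero)
    · refine .inr ⟨by simp [logPowerPotential, h.not_gt], logBound_zero_of_pos h, ?_⟩
      have h₁ := (tendsto_rpow_mul_log_nhdsGT_zero h).div_const b
      simp only [Real.log_zero, mul_zero]
      rw [zero_div] at h₁
      exact h₁.congr fun r => by ring

end InteractionEnergy

end

theorem theorem3p6 (d : ℕ) (hd : 0 < d) :
    (∀ b : ℝ, -(d : ℝ) < b → b < 0 →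
      InteractionEnergy.FourierRepresentable 0 (InteractionEnergy.powerPotential d b)) ∧
    (∀ b : ℝ, 0 ≤ b → b < 2 →
      InteractionEnergy.FourierRepresentable 1 (InteractionEnergy.powerPotential d b)) ∧
    (∀ b : ℝ, 2 ≤ b → b < 4 →
      InteractionEnergy.FourierRepresentable 2 (InteractionEnergy.powerPotential d b)) ∧
    (∀ a b : ℝ, -(d : ℝ) < b → b < a → a < 4 →
      InteractionEnergy.FourierRepresentable 2 (InteractionEnergy.attrRepPotential d a b)) ∧
    (∀ b : ℝ, -(d : ℝ) < b → b < 0 →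
      InteractionEnergy.FourierRepresentable 0 (InteractionEnergy.logPowerPotential d b)) ∧
    (∀ b : ℝ, 0 < b → b < 2 →
      InteractionEnergy.FourierRepresentable 1 (InteractionEnergy.logPowerPotential d b)) ∧
    (∀ b : ℝ, 2 ≤ b → b < 4 →
      InteractionEnergy.FourierRepresentable 2 (InteractionEnergy.logPowerPotential d b)) := by
  have hd' : -(d : ℝ) < 0 := neg_lt_zero.2 (Nat.cast_pos.2 hd)
  have l0 {b : ℝ} (h : b < 0) : InteractionEnergy.powerLevel b = 0 := if_pos h
  have l1 {b : ℝ} (h : 0 ≤ b) (h' : b < 2) : InteractionEnergy.powerLevel b = 1 := by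
    simp [InteractionEnergy.powerLevel, h.not_gt, h']
  have l2 {b : ℝ} (h : 2 ≤ b) : InteractionEnergy.powerLevel b = 2 := by
    simp [InteractionEnergy.powerLevel, h.not_gt, (zero_le_two.trans h).not_gt]
  refine ⟨fun b h₁ h₂ => ?_, fun b h₁ h₂ => ?_, fun b h₁ h₂ => ?_, fun a b h₁ h₂ h₃ =>
    InteractionEnergy.fourierRepresentable_attrRepPotential hd h₁ h₂ h₃,
    fun b h₁ h₂ => ?_, fun b h₁ h₂ => ?_, fun b h₁ h₂ => ?_⟩
  · exact l0 h₂ ▸ InteractionEnergy.fourierRepresentable_powerPotential hd h₁ (by linarith)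
  · exact l1 h₁ h₂ ▸ InteractionEnergy.fourierRepresentable_powerPotential hd
      (by linarith) (by linarith)
  · exact l2 h₁ ▸ InteractionEnergy.fourierRepresentable_powerPotential hd (by linarith) h₂
  · exact l0 h₂ ▸ InteractionEnergy.fourierRepresentable_logPowerPotential hd h₁ h₂.ne
      (by linarith)
  · exact l1 h₁.le h₂ ▸ InteractionEnergy.fourierRepresentable_logPowerPotential hd
      (by linarith) h₁.ne' (by linarith)
  · exact l2 h₁ ▸ InteractionEnergy.fourierRepresentable_logPowerPotential hd (by linarith)
      (by linarith : 0 < b).ne' h₂
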